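/- **Setting.** For $n$ qubits and $j\in\{1,\dots,n\}$ let $P_j=Z_1\cdots Z_{j-1}X_j$ and $Q_j=Z_1\cdots Z_{j-1}Y_j$ be the $2n$ Majorana operators under the Jordan-Wigner mapping. A *circuit* acts on one or more copies of the $n$-qubit register; it is a sequence of layers, each layer consisting of Hadamard, phase, inverse phase and CNOT gates on pairwise disjoint qubits (any two qubits may be coupled by a CNOT); its depth is the number of layers, and it is followed by a measurement of all qubits in the computational basis. Measuring an observable $O$ with a circuit of unitary $U$ means that the basis $\{U^\dagger|b\rangle\}$ consists of eigenvectors of $O$ and that the corresponding eigenvalue is read off from the outcome $b$. The preparation of the state is not counted in the depth. The *sample complexity* of a protocol is the number of copies of $\rho$ consumed, and its *number of circuits* the number of different measurement circuits run in one execution, both in the worst case over the measurement outcomes. **Protocol** (parameters $\epsilon>0$ and numbers of shots $N_1,N_2,N_3$). 1. Run Bell sampling on $\rho\otimes\rho$ ($N_1$ shots): for every $j$, qubit $j$ of the first copy and qubit $j$ of the second are measured in the Bell basis. For each $O\in\{P_j,Q_j\}$ let $m_O$ be the square root of the empirical mean of $O\otimes O$ (of $0$ if that mean is negative). 2. Keep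 only the operators with $m_O\ge \frac{3\epsilon}{4}$: $P_{r_1},\dots,P_{r_I}$ with $r_1<\dots<r_I$, and $Q_{k_1},\dots,Q_{k_J}$ with $k_1<\dots<k_J$. 3. If $I\ge1$, measure $P_{r_1}$ on single copies ($N_2$ shots) and let $p^{(2)}$ be the empirical mean. Then measure on $\rho\otimes\rho$ ($N_3$ shots) all the operators $P_{r_i}\otimes P_{r_{i+1}}$, $1\le i<I$, simultaneously, in the basis given by Bell states on the pairs (qubit $r_i$ of the first copy, qubit $r_{i+1}$ of the second copy) and the computational basis on the remaining qubits, and let $p^{(3)}_i$ be the empirical means. The sign assigned to $P_{r_i}$ is $s_{P_{r_i}}=\operatorname{sign}\big(p^{(2)}p^{(3)}_1\cdots p^{(3)}_{i-1}\big)$. Do the same for the operators $Q_{k_j}$. 4. The estimate of $\operatorname{tr}(\rho O)$ is $s_O\,m_O$ for every surviving $O$ and $0$ for every other $O$. (The empirical mean over zero shots is taken to be $0$.) **Lemma (chained measurement strategy).** (a) The measurements above are well defined: the Bell basis of step 1 consists of common eigenvectors of all the operators $P_j\otimes P_j$ and $Q_j\otimes Q_j$; for every $r_1<\dots<r_I$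 the operators $P_{r_i}\otimes P_{r_{i+1}}$ commute mutually and the basis of step 3 consists of common eigenvectors of them; the same holds for the $Q$'s; and each single operator $P_j$ or $Q_j$ is measured by a single-copy circuit of depth at most $2$. (b) There is a universal constant $C>0$ such that for all $n\ge2$, $\epsilon>0$ with $n\ge\frac1{\epsilon^2}$ and $\delta\in(0,1)$ there are $N_1,N_2,N_3$, depending only on $n,\epsilon,\delta$, for which the protocol measures at most two copies jointly, has sample complexity at most $C\,\frac{\log(n/\delta)}{\epsilon^4}$ (hence $\mathcal O\big(\frac{\log n}{\epsilon^4}\big)$ for fixed $\delta$), and uses at most $5=\mathcal O(1)$ circuits, each of depth at most $2=\mathcal O(1)$; and for every $n$-qubit density matrix $\rho$ the following hold simultaneously, with probability at least $1-\delta$, for all $2n$ operators $O$: $\big|m_O-|\operatorname{tr}(\rho O)|\big|\le\frac{\epsilon}{4}$; if $|\operatorname{tr}(\rho O)|\ge\epsilon$ then $O$ survives, and if $O$ survives then $|\operatorname{tr}(\rho O)|\ge\frac{\epsilon}{2}$; if $O$ survives then $s_O=\operatorname{sign}\operatorname{tr}(\rho O)$; and the estimate of $\operatorname{tr}(\rho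 O)$ has additive error at most $\epsilon$. -/

import Mathlib

open scoped Matrix ComplexOrder

namespace ChainedTomography

/-! ### Qubits, Pauli strings and tensor products -/

/-- Labels of the computational basis of a register whose qubits are indexed by `ι`. -/
abbrev Bits (ι : Type) : Type := ι → Bool

/-- Operators on the register `ι`, as matrices in the computational basis. -/
abbrev QOp (ι : Type) : Type := Matrix (Bits ι) (Bits ι) ℂ

/-- The tensor product, over the qubits of a register, of one-qubit operators. -/
noncomputable def tensorOp {ι : Type} [Fintype ι] (M : ι → Matrix Bool Bool ℂ) : QOp ι :=
  Matrix.of fun x y => ∏ i, M i (x i) (y i)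

/-- The four one-qubit Pauli letters. -/
inductive Pauli : Type
  | I
  | X
  | Y
  | Z

/-- The Pauli matrices (`false` is the basis vector 0 and `true` is the basis vector 1). -/
noncomputable def Pauli.mat : Pauli → Matrix Bool Bool ℂ
  | .I => 1
  | .X => Matrix.of fun a b => if a = b then 0 else 1
  | .Y => Matrix.of fun a b => if a = b then 0 else if a then Complex.I else -Complex.I
  | .Z => Matrix.diagonal fun a => if a then -1 else 1

/-- The two families of Jordan-Wigner Majorana operators. -/
inductive Axis : Type
  | x
  | y

/-- The Pauli letter that a family carries at the end of its `Z`-string. -/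
def Axis.pauli : Axis → Pauli
  | .x => .X
  | .y => .Y

/-- The Jordan-Wigner Majorana operators on `n` qubits, `Z ⋯ Z X_j` and `Z ⋯ Z Y_j`, with
`Z` on all the qubits before `j` and the identity on all the qubits after `j`. -/
noncomputable def majorana {n : ℕ} (a : Axis) (j : Fin n) : QOp (Fin n) :=
  tensorOp fun q => (if q < j then Pauli.Z else if q = j then a.pauli else Pauli.I).mat

/-- The operator `A 0 ⊗ ⋯ ⊗ A (k - 1)` on `k` copies of an `n`-qubit register; the qubit
`(c, j)` is qubit `j` of copy `c`. -/
noncomputable def copyTensor {n k : ℕ} (A : Fin k → QOp (Fin n)) : QOp (Fin k × Fin n) :=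
  Matrix.of fun x y => ∏ c, A c (fun j => x (c, j)) (fun j => y (c, j))

/-- Density matrices. -/
def IsState {ι : Type} [Fintype ι] [DecidableEq ι] (ρ : QOp ι) : Prop :=
  ρ.PosSemidef ∧ ρ.trace = 1

/-- The expectation value `tr (ρ O)` of an observable. -/
noncomputable def expectation {ι : Type} [Fintype ι] [DecidableEq ι] (ρ O : QOp ι) : ℝ :=
  (ρ * O).trace.re

/-! ### Circuits and measurements -/

/-- Elementary gates: Hadamard, phase gate, inverse phase gate, and controlled-NOT with control
`c` and target `t`. -/
inductive Gate (ι : Type) : Type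
  | H (i : ι)
  | S (i : ι)
  | Sdg (i : ι)
  | CNOT (c t : ι)

/-- The qubits on which a gate acts. -/
def Gate.qubits {ι : Type} : Gate ι → List ι
  | .H i => [i]
  | .S i => [i]
  | .Sdg i => [i]
  | .CNOT c t => [c, t]

/-- A one-qubit operator acting on qubit `i` of a register. -/
noncomputable def applyAt {ι : Type} [Fintype ι] [DecidableEq ι] (i : ι)
    (A : Matrix Bool Bool ℂ) : QOp ι :=
  tensorOp (Function.update (fun _ => 1) i A)

/-- The operator of a gate. -/
noncomputable def Gate.op {ι : Type} [Fintype ι] [DecidableEq ι] : Gate ι → QOp ι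
  | .H i => applyAt i (Matrix.of fun a b => (if a && b then -1 else 1) / (Real.sqrt 2 : ℂ))
  | .S i => applyAt i (Matrix.diagonal fun a => if a then Complex.I else 1)
  | .Sdg i => applyAt i (Matrix.diagonal fun a => if a then -Complex.I else 1)
  | .CNOT c t => Matrix.of fun x y => if x = Function.update y t (xor (y t) (y c)) then 1 else 0

/-- A circuit is a list of layers, the first one being applied first. -/
abbrev Circuit (ι : Type) : Type := List (List (Gate ι))

/-- In every layer the gates act on pairwise different qubits (which also forces the control of
a controlled-NOT to differ from its target), so that a layer is executed in one time step. -/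
def Circuit.Valid {ι : Type} (C : Circuit ι) : Prop :=
  ∀ layer ∈ C, (layer.flatMap Gate.qubits).Nodup

/-- The depth: the number of layers. -/
def Circuit.depth {ι : Type} (C : Circuit ι) : ℕ := C.length

/-- The operator of a sequence of gates, the first gate of the list being applied first. -/
noncomputable def gatesOp {ι : Type} [Fintype ι] [DecidableEq ι] : List (Gate ι) → QOp ι
  | [] => 1
  | g :: gs => gatesOp gs * g.op

/-- The operator of a circuit. -/
noncomputable def Circuit.op {ι : Type} [Fintype ι] [DecidableEq ι] (C : Circuit ι) : QOp ι :=
  gatesOp C.flatten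

/-- Born rule: the probability of the outcome `b` when `C` is applied to the state `σ` and all
the qubits are then measured in the computational basis. -/
noncomputable def Circuit.born {ι : Type} [Fintype ι] [DecidableEq ι] (C : Circuit ι)
    (σ : QOp ι) (b : Bits ι) : ℝ :=
  ((C.op * σ * C.opᴴ) b b).re

/-- The basis `U† |b⟩` in which the circuit with operator `U` measures consists of eigenvectors
of the observable `O`. -/
def Circuit.Measures {ι : Type} [Fintype ι] [DecidableEq ι] (C : Circuit ι) (O : QOp ι) :
    Prop :=
  (C.op * O * C.opᴴ).IsDiag

/-- The value of the observable `O` that is read off from the outcome `b`, namely the eigenvalue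
`⟨b| U O U† |b⟩` of `O` at the measured basis vector `U† |b⟩`. -/
noncomputable def Circuit.readout {ι : Type} [Fintype ι] [DecidableEq ι] (C : Circuit ι)
    (O : QOp ι) (b : Bits ι) : ℝ :=
  ((C.op * O * C.opᴴ) b b).re

/-- The empirical mean of the values of `O` over `N` shots of the circuit `C`. -/
noncomputable def Circuit.mean {ι : Type} [Fintype ι] [DecidableEq ι] (C : Circuit ι)
    (O : QOp ι) {N : ℕ} (w : Fin N → Bits ι) : ℝ :=
  (∑ s, C.readout O (w s)) / N

/-! ### Adaptive measurement protocols -/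

/-- An adaptive protocol on copies of an `n`-qubit state, with a result in `R`. Either it stops
with a result, or it runs a circuit on `k` fresh copies at a time, `N` times, and goes on in a
way that may depend on the `N` outcomes. -/
inductive Protocol (n : ℕ) (R : Type) : Type
  | done (r : R)
  | run (k : ℕ) (C : Circuit (Fin k × Fin n)) (N : ℕ)
      (next : (Fin N → Bits (Fin k × Fin n)) → Protocol n R)

namespace Protocol

open Classical in
/-- The probability that the result satisfies `E` when the protocol is run on copies of `ρ`. -/
noncomputable def prob {n : ℕ} {R : Type} (ρ : QOp (Fin n)) (E : R → Prop) :
    Protocol n R → ℝ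
  | done r => if E r then 1 else 0
  | run _ C _ next => ∑ w, (∏ s, C.born (copyTensor fun _ => ρ) (w s)) * prob ρ E (next w)

/-- All circuits are valid. -/
def Valid {n : ℕ} {R : Type} : Protocol n R → Prop
  | done _ => True
  | run _ C _ next => C.Valid ∧ ∀ w, Valid (next w)

/-- The sample complexity: the number of copies of the state consumed, in the worst case over
the outcomes. -/
def samples {n : ℕ} {R : Type} : Protocol n R → ℕ
  | done _ => 0
  | run k _ N next => k * N + Finset.univ.sup fun w => samples (next w)

/-- The number of circuits that are used, in the worst case over the outcomes. -/
def circuits {n : ℕ} {R : Type} : Protocol n R → ℕ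
  | done _ => 0
  | run _ _ _ next => 1 + Finset.univ.sup fun w => circuits (next w)

/-- The largest depth of a circuit, in the worst case over the outcomes. -/
def depth {n : ℕ} {R : Type} : Protocol n R → ℕ
  | done _ => 0
  | run _ C _ next => max C.depth (Finset.univ.sup fun w => depth (next w))

/-- The largest number of copies that are measured jointly, in the worst case over the
outcomes. -/
def width {n : ℕ} {R : Type} : Protocol n R → ℕ
  | done _ => 0
  | run k _ _ next => max k (Finset.univ.sup fun w => width (next w))

end Protocol

/-! ### The chained measurement protocol -/

/-- Bell measurement of qubit `j` of the first copy with qubit `j` of the second, for all `j`. -/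
def bellCircuit (n : ℕ) : Circuit (Fin 2 × Fin n) :=
  [(List.finRange n).map fun j => Gate.CNOT (0, j) (1, j),
   (List.finRange n).map fun j => Gate.H (0, j)]

/-- The single-copy measurement of one Majorana operator: qubit `j` in the eigenbasis of `X` or
of `Y`, all other qubits in the computational basis. -/
def firstCircuit {n : ℕ} : Axis → Fin n → Circuit (Fin 1 × Fin n)
  | .x, j => [[Gate.H (0, j)]]
  | .y, j => [[Gate.Sdg (0, j)], [Gate.H (0, j)]]

/-- The links `(r₁, r₂), (r₂, r₃), …` of the chain `r₁, r₂, r₃, …`. -/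
def links {n : ℕ} (L : List (Fin n)) : List (Fin n × Fin n) := L.zip L.tail

/-- Bell measurement of qubit `r_i` of the first copy with qubit `r_{i+1}` of the second, for
all the links of the chain; all other qubits are measured in the computational basis. -/
def chainCircuit {n : ℕ} (L : List (Fin n)) : Circuit (Fin 2 × Fin n) :=
  [(links L).map fun p => Gate.CNOT (0, p.1) (1, p.2),
   (links L).map fun p => Gate.H (0, p.1)]

/-- The two-copy observable `P_i ⊗ P_j`, for Majorana operators of one family. -/
noncomputable def pairOp {n : ℕ} (a : Axis) (i j : Fin n) : QOp (Fin 2 × Fin n) :=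
  copyTensor ![majorana a i, majorana a j]

/-- From the estimate `p₂` of the first expectation value and the estimates `p₃` of the products
along the links, the sign at `j` is that of `p₂ · p₃(r₁, r₂) · p₃(r₂, r₃) ⋯`, up to the link
that ends in `j`. -/
noncomputable def chainSign {n : ℕ} (L : List (Fin n)) (p₂ : ℝ) (p₃ : Fin n × Fin n → ℝ)
    (j : Fin n) : SignType :=
  SignType.sign (p₂ * (((links L).filter fun p => decide (p.2 ≤ j)).map p₃).prod)

/-- The sign determination for one family whose surviving operators are listed in `L`: a
single-copy measurement of the first one (`N₂` shots), then a two-copy measurement of all the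
links of the chain (`N₃` shots). Nothing is measured if no operator has survived. -/
noncomputable def chainStep {n : ℕ} {R : Type} (a : Axis) (L : List (Fin n)) (N₂ N₃ : ℕ)
    (next : (Fin n → SignType) → Protocol n R) : Protocol n R :=
  match L with
  | [] => next fun _ => 0
  | r :: T =>
    .run 1 (firstCircuit a r) N₂ fun w₂ =>
    .run 2 (chainCircuit (r :: T)) N₃ fun w₃ =>
    next (chainSign (r :: T)
      ((firstCircuit a r).mean (copyTensor fun _ => majorana a r) w₂)
      fun p => (chainCircuit (r :: T)).mean (pairOp a p.1 p.2) w₃)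

/-- What the protocol returns, for both families of Majorana operators. -/
structure Result (n : ℕ) : Type where
  /-- estimates of the magnitudes of the expectation values -/
  magnitude : Axis → Fin n → ℝ
  /-- the operators that survive the thresholding -/
  survivors : Axis → Finset (Fin n)
  /-- the signs found for the surviving operators -/
  sign : Axis → Fin n → SignType

/-- The resulting estimates of the expectation values: signed magnitude for the surviving
operators, zero for the others. -/
noncomputable def Result.estimate {n : ℕ} (res : Result n) (a : Axis) (j : Fin n) : ℝ :=
  if j ∈ res.survivors a then (res.sign a j : ℝ) * res.magnitude a j else 0

/-- Magnitudes estimated from `N` outcomes of Bell sampling: the mean of `P_j ⊗ P_j` estimates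
the square of the expectation value of `P_j` (`Real.sqrt` of a negative number is zero). -/
noncomputable def bellMagnitude {n N : ℕ} (w : Fin N → Bits (Fin 2 × Fin n)) (a : Axis)
    (j : Fin n) : ℝ :=
  Real.sqrt ((bellCircuit n).mean (pairOp a j j) w)

/-- The operators of a family whose estimated magnitude is at least `3 ε / 4`. -/
noncomputable def surviving {n N : ℕ} (ε : ℝ) (w : Fin N → Bits (Fin 2 × Fin n)) (a : Axis) :
    Finset (Fin n) :=
  Finset.univ.filter fun j => 3 * ε / 4 ≤ bellMagnitude w a j

/-- The chained measurement protocol with threshold `3 ε / 4`: Bell sampling with `N₁` shots,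
thresholding, and the sign determination along the chain of each of the two families, in
increasing order of the surviving indices. -/
noncomputable def chainedProtocol (n : ℕ) (ε : ℝ) (N₁ N₂ N₃ : ℕ) : Protocol n (Result n) :=
  .run 2 (bellCircuit n) N₁ fun w =>
  chainStep .x ((surviving ε w .x).sort (· ≤ ·)) N₂ N₃ fun sx =>
  chainStep .y ((surviving ε w .y).sort (· ≤ ·)) N₂ N₃ fun sy =>
  .done
    { magnitude := bellMagnitude w
      survivors := surviving ε w
      sign := fun a => match a with
        | .x => sx
        | .y => sy }

/-- The result is correct for the state `ρ` to precision `ε`: all magnitudes are found up to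
`ε / 4`; every operator whose expectation value is at least `ε` in magnitude survives, and the
magnitude for every surviving one is at least `ε / 2`; the signs of the expectation values of
all the surviving operators are right; and all the estimates have additive error at most `ε`. -/
def Result.Correct {n : ℕ} (ρ : QOp (Fin n)) (ε : ℝ) (res : Result n) : Prop :=
  ∀ (a : Axis) (j : Fin n),
    |res.magnitude a j - abs (expectation ρ (majorana a j))| ≤ ε / 4 ∧
    (ε ≤ |expectation ρ (majorana a j)| → j ∈ res.survivors a) ∧
    (j ∈ res.survivors a → ε / 2 ≤ |expectation ρ (majorana a j)|) ∧
    (j ∈ res.survivors a → res.sign a j = SignType.sign (expectation ρ (majorana a j))) ∧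
    |res.estimate a j - expectation ρ (majorana a j)| ≤ ε

end ChainedTomography

/-!
The protocol works for two reasons.

*Measurability.* A controlled-NOT maps `P ⊗ P`, for a Pauli letter `P`, to a product of an operator
in the span of `1` and `X` on the control and a diagonal one on the target
(`Pauli.exists_cnot_conj`), and a Hadamard gate on the control diagonalises the former. So Bell
measurements on disjoint pairs of qubits measure every Pauli string whose letters agree on each pair
and are `I` or `Z` elsewhere (`bellPairsCircuit_measures`). For `P_j ⊗ P_j` this is plain. For
`P_{r_i} ⊗ P_{r_{i+1}}` the letters agree at the pair `(r_k, r_{k+1})` because `r_k` is before, at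
or after `r_i` exactly when `r_{k+1}` is before, at or after `r_{i+1}` (`links_letter_eq`). The
links commute since one circuit diagonalises all of them.

*Accuracy.* All measured observables have square one, so that their readouts are `1` or `-1`, with
expectation `tr (σ O)`. By a Hoeffding bound, proved here for finite sums, and a union bound, the at
most `2 n` empirical means of one circuit are all within `η = ε² / 16` of their expectations, except
with probability `4 n exp (- N η² / 16)` (`le_sum_born_forall_close`). An error `(ε / 4)²` in
`tr (ρ O)²` is an error of at most `ε / 4` in `|tr (ρ O)|` (`abs_sqrt_sub_le`), so every survivor has
`|tr (ρ O)| ≥ ε / 2`. As `η` is less than `ε / 2` and than `(ε / 2)²`, the empirical means of the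
first operator and of the links have the right signs, and the product of signs along the chain
telescopes (`chainSign_eq`). With `N` of order `log (n / δ) / ε⁴` shots each of the at most five
circuits fails with probability at most `δ / 5`. The choice of `η` needs `ε < 8`, and rounding `N`
up must not dominate the bound on the sample complexity; for `ε ≥ 4` zero shots are enough, as
`|tr (ρ O)| ≤ 1`.
-/

namespace ChainedTomography

/-! ### Tensor products -/

section Tensor

variable {ι : Type} [Fintype ι]

theorem tensorOp_mul [DecidableEq ι] (M N : ι → Matrix Bool Bool ℂ) :
    tensorOp M * tensorOp N = tensorOp fun i => M i * N i := by
  ext x y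
  simp only [tensorOp, Matrix.mul_apply, Matrix.of_apply, ← Finset.prod_mul_distrib]
  rw [Fintype.prod_sum]

theorem tensorOp_conjTranspose (M : ι → Matrix Bool Bool ℂ) :
    (tensorOp M)ᴴ = tensorOp fun i => (M i)ᴴ := by
  ext x y
  simp [tensorOp, Matrix.conjTranspose_apply]

theorem tensorOp_isDiag {M : ι → Matrix Bool Bool ℂ} (h : ∀ i, (M i).IsDiag) :
    (tensorOp M).IsDiag := by
  intro x y hxy
  obtain ⟨i, hi⟩ := Function.ne_iff.mp hxy
  exact Finset.prod_eq_zero (Finset.mem_univ i) (h i hi)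

theorem tensorOp_one [DecidableEq ι] : tensorOp (fun _ : ι => (1 : Matrix Bool Bool ℂ)) = 1 := by
  ext x y
  by_cases hxy : x = y
  · subst hxy
    simp [tensorOp]
  · rw [Matrix.one_apply_ne hxy]
    exact tensorOp_isDiag (fun _ => Matrix.isDiag_one) hxy

end Tensor

section Copies

variable {n k : ℕ}

theorem copyTensor_mul (A B : Fin k → QOp (Fin n)) :
    copyTensor A * copyTensor B = copyTensor fun c => A c * B c := by
  ext x y
  simp only [copyTensor, Matrix.mul_apply, Matrix.of_apply, ← Finset.prod_mul_distrib]
  rw [Fintype.prod_sum]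
  exact Fintype.sum_equiv (Equiv.curry (Fin k) (Fin n) Bool) _ _ fun _ => rfl

theorem copyTensor_conjTranspose (A : Fin k → QOp (Fin n)) :
    (copyTensor A)ᴴ = copyTensor fun c => (A c)ᴴ := by
  ext x y
  simp [copyTensor, Matrix.conjTranspose_apply]

theorem trace_copyTensor (A : Fin k → QOp (Fin n)) :
    (copyTensor A).trace = ∏ c, (A c).trace := by
  simp only [copyTensor, Matrix.trace, Matrix.diag_apply, Matrix.of_apply]
  rw [Fintype.prod_sum]
  exact Fintype.sum_equiv (Equiv.curry (Fin k) (Fin n) Bool) _ _ fun _ => rfl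

theorem copyTensor_tensorOp (M : Fin k → Fin n → Matrix Bool Bool ℂ) :
    copyTensor (fun c => tensorOp (M c)) = tensorOp fun q : Fin k × Fin n => M q.1 q.2 := by
  ext x y
  simp only [copyTensor, tensorOp, Matrix.of_apply, Fintype.prod_prod_type]

theorem copyTensor_one : copyTensor (fun _ : Fin k => (1 : QOp (Fin n))) = 1 := by
  simp only [← tensorOp_one, copyTensor_tensorOp]

open scoped MatrixOrder Matrix.Norms.L2Operator in
theorem IsState.copyTensor {ρ : QOp (Fin n)} (hρ : IsState ρ) :
    IsState (copyTensor fun _ : Fin k => ρ) := by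
  refine ⟨?_, by simp [trace_copyTensor, hρ.2]⟩
  obtain ⟨B, rfl⟩ := CStarAlgebra.nonneg_iff_eq_star_mul_self.mp hρ.1.nonneg
  rw [Matrix.star_eq_conjTranspose, ← copyTensor_mul (fun _ => Bᴴ) (fun _ => B),
    ← copyTensor_conjTranspose]
  exact Matrix.posSemidef_conjTranspose_mul_self _

end Copies

/-! ### Majorana operators -/

theorem Pauli.mat_mul_self (P : Pauli) : P.mat * P.mat = 1 := by
  cases P <;> ext a b <;> cases a <;> cases b <;> simp [Pauli.mat, Matrix.mul_apply]

theorem Pauli.mat_isHermitian (P : Pauli) : P.matᴴ = P.mat := by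
  cases P <;> ext a b <;> cases a <;> cases b <;>
    simp [Pauli.mat, Matrix.conjTranspose_apply]

/-- The Pauli letter of the Majorana operator `majorana a j` at qubit `q`. -/
def majoranaLetter {n : ℕ} (a : Axis) (j q : Fin n) : Pauli :=
  if q < j then Pauli.Z else if q = j then a.pauli else Pauli.I

theorem majorana_eq {n : ℕ} (a : Axis) (j : Fin n) :
    majorana a j = tensorOp fun q => (majoranaLetter a j q).mat := rfl

theorem majoranaLetter_isDiag {n : ℕ} (a : Axis) {j q : Fin n} (h : q ≠ j) :
    (majoranaLetter a j q).mat.IsDiag := by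
  unfold majoranaLetter
  split_ifs
  · exact Matrix.isDiag_diagonal _
  · exact Matrix.isDiag_one

theorem majorana_mul_self {n : ℕ} (a : Axis) (j : Fin n) : majorana a j * majorana a j = 1 := by
  simp [majorana_eq, tensorOp_mul, Pauli.mat_mul_self, tensorOp_one]

theorem majorana_conjTranspose {n : ℕ} (a : Axis) (j : Fin n) :
    (majorana a j)ᴴ = majorana a j := by
  simp [majorana_eq, tensorOp_conjTranspose, Pauli.mat_isHermitian]

theorem pairOp_mul_self {n : ℕ} (a : Axis) (i j : Fin n) : pairOp a i j * pairOp a i j = 1 := by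
  rw [pairOp, copyTensor_mul, ← copyTensor_one]
  congr 1
  ext1 c
  fin_cases c <;> simp [majorana_mul_self]

theorem pairOp_eq {n : ℕ} (a : Axis) (i j : Fin n) :
    pairOp a i j =
      tensorOp fun q : Fin 2 × Fin n => (majoranaLetter a (![i, j] q.1) q.2).mat := by
  rw [← copyTensor_tensorOp (k := 2) fun c q => (majoranaLetter a (![i, j] c) q).mat, pairOp]
  congr 1
  ext1 c
  fin_cases c <;> simp [majorana_eq]

/-! ### Unitarity of circuits -/

section Gates

variable {ι : Type} [DecidableEq ι]

/-- The action of a controlled-NOT on the computational basis. -/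
def cnotFun (c t : ι) (x : Bits ι) : Bits ι := Function.update x t (xor (x t) (x c))

theorem cnotFun_involutive {c t : ι} (h : c ≠ t) : Function.Involutive (cnotFun c t) := by
  intro x
  ext q
  by_cases hq : q = t
  · subst hq; simp [cnotFun, h]
  · simp [cnotFun, hq]

variable [Fintype ι]

/-- The matrix of the Hadamard gate. -/
noncomputable def hadamard : Matrix Bool Bool ℂ :=
  Matrix.of fun a b => (if a && b then -1 else 1) / (Real.sqrt 2 : ℂ)

/-- The matrix of the inverse phase gate. -/
noncomputable def phaseInv : Matrix Bool Bool ℂ :=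
  Matrix.diagonal fun a => if a then -Complex.I else 1

theorem inv_sqrt_two_mul_self : ((Real.sqrt 2 : ℂ))⁻¹ * (Real.sqrt 2 : ℂ)⁻¹ = 1 / 2 := by
  rw [← mul_inv, ← Complex.ofReal_mul, Real.mul_self_sqrt (by norm_num)]
  norm_num

theorem hadamard_unitary : hadamardᴴ * hadamard = 1 := by
  ext a b
  cases a <;> cases b <;>
    simp [hadamard, Matrix.mul_apply, Matrix.conjTranspose_apply, div_eq_mul_inv,
      inv_sqrt_two_mul_self]
  norm_num

/-- Conjugating a one-qubit factor of a tensor product. -/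
theorem applyAt_conj (i : ι) (A : Matrix Bool Bool ℂ) (M : ι → Matrix Bool Bool ℂ) :
    applyAt i A * tensorOp M * (applyAt i A)ᴴ =
      tensorOp (Function.update M i (A * M i * Aᴴ)) := by
  rw [applyAt, tensorOp_conjTranspose, tensorOp_mul, tensorOp_mul]
  congr 1
  ext1 q
  by_cases h : q = i
  · subst h; simp
  · simp [h]

theorem applyAt_unitary (i : ι) {A : Matrix Bool Bool ℂ} (hA : Aᴴ * A = 1) :
    (applyAt i A)ᴴ * applyAt i A = 1 := by
  rw [applyAt, tensorOp_conjTranspose, tensorOp_mul, ← tensorOp_one]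
  congr 1
  ext1 q
  by_cases h : q = i
  · subst h; simpa using hA
  · simp [h]

theorem cnot_op_apply (c t : ι) (x y : Bits ι) :
    (Gate.CNOT c t).op x y = if x = cnotFun c t y then 1 else 0 := rfl

theorem cnot_conj_apply {c t : ι} (h : c ≠ t) (O : QOp ι) (x y : Bits ι) :
    ((Gate.CNOT c t).op * O * (Gate.CNOT c t).opᴴ) x y = O (cnotFun c t x) (cnotFun c t y) := by
  have e : ∀ x z : Bits ι,
      (Gate.CNOT c t).op x z = if z = cnotFun c t x then 1 else 0 := fun x z => by
    rw [cnot_op_apply]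
    exact if_congr ⟨fun h' => by rw [h', cnotFun_involutive h],
      fun h' => by rw [h', cnotFun_involutive h]⟩ rfl rfl
  simp [Matrix.mul_apply, Matrix.conjTranspose_apply, e, apply_ite]

theorem cnot_unitary {c t : ι} (h : c ≠ t) :
    (Gate.CNOT c t).opᴴ * (Gate.CNOT c t).op = 1 := by
  rw [mul_eq_one_comm]
  ext x y
  have := cnot_conj_apply h (1 : QOp ι) x y
  rw [Matrix.mul_one] at this
  rw [this]
  simp only [Matrix.one_apply, (cnotFun_involutive h).injective.eq_iff]

theorem Gate.op_unitary (g : Gate ι) (h : g.qubits.Nodup) : g.opᴴ * g.op = 1 := by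
  cases g with
  | H i => exact applyAt_unitary i hadamard_unitary
  | S i =>
    refine applyAt_unitary i ?_
    ext a b
    cases a <;> cases b <;> simp [Matrix.mul_apply]
  | Sdg i =>
    refine applyAt_unitary i ?_
    ext a b
    cases a <;> cases b <;> simp [Matrix.mul_apply]
  | CNOT c t => exact cnot_unitary (by simpa [Gate.qubits] using h)

theorem gatesOp_unitary {gs : List (Gate ι)} (h : ∀ g ∈ gs, g.qubits.Nodup) :
    (gatesOp gs)ᴴ * gatesOp gs = 1 := by
  induction gs with
  | nil => simp [gatesOp]
  | cons g gs ih =>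
    have h1 := ih fun g' hg' => h g' (List.mem_cons_of_mem _ hg')
    have h2 := Gate.op_unitary g (h g List.mem_cons_self)
    rw [gatesOp, Matrix.conjTranspose_mul, Matrix.mul_assoc, ← Matrix.mul_assoc _ (gatesOp gs),
      h1, Matrix.one_mul, h2]

theorem gatesOp_append (gs hs : List (Gate ι)) :
    gatesOp (gs ++ hs) = gatesOp hs * gatesOp gs := by
  induction gs with
  | nil => simp [gatesOp]
  | cons g gs ih => rw [List.cons_append, gatesOp, gatesOp, ih, Matrix.mul_assoc]

theorem Circuit.Valid.op_unitary {C : Circuit ι} (h : C.Valid) : C.opᴴ * C.op = 1 := by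
  refine gatesOp_unitary fun g hg => ?_
  obtain ⟨l, hl, hgl⟩ := List.mem_flatten.mp hg
  exact (List.nodup_flatMap.mp (h l hl)).1 g hgl

theorem gatesOp_cons_conj (g : Gate ι) (gs : List (Gate ι)) (O : QOp ι) :
    gatesOp (g :: gs) * O * (gatesOp (g :: gs))ᴴ =
      gatesOp gs * (g.op * O * g.opᴴ) * (gatesOp gs)ᴴ := by
  simp only [gatesOp, Matrix.conjTranspose_mul, Matrix.mul_assoc]

theorem gatesOp_append_conj (gs hs : List (Gate ι)) (O : QOp ι) :
    gatesOp (gs ++ hs) * O * (gatesOp (gs ++ hs))ᴴ =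
      gatesOp hs * (gatesOp gs * O * (gatesOp gs)ᴴ) * (gatesOp hs)ᴴ := by
  simp only [gatesOp_append, Matrix.conjTranspose_mul, Matrix.mul_assoc]

/-- Observables measured by one valid circuit are simultaneously diagonalised by it, hence
commute. -/
theorem Circuit.Measures.commute {C : Circuit ι} (hC : C.Valid) {O O' : QOp ι}
    (h : C.Measures O) (h' : C.Measures O') : Commute O O' := by
  have hU := hC.op_unitary
  have key : ∀ A B : QOp ι, A * B =
      C.opᴴ * ((C.op * A * C.opᴴ) * (C.op * B * C.opᴴ)) * C.op := by
    intro A B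
    calc A * B = (C.opᴴ * C.op) * A * (C.opᴴ * C.op) * B * (C.opᴴ * C.op) := by simp [hU]
      _ = _ := by simp only [Matrix.mul_assoc]
  have hd := h.diagonal_diag
  have hd' := h'.diagonal_diag
  rw [Commute, SemiconjBy, key O O', key O' O, ← hd, ← hd', Matrix.diagonal_mul_diagonal,
    Matrix.diagonal_mul_diagonal]
  simp only [mul_comm]

end Gates

/-! ### Diagonalisation by Bell measurements -/

/-- The span of the identity and of `X`: the one-qubit operators that are diagonal in the basis
into which a Hadamard gate rotates. -/
def IsXType (A : Matrix Bool Bool ℂ) : Prop :=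
  A false false = A true true ∧ A false true = A true false

theorem IsXType.hadamard_conj {A : Matrix Bool Bool ℂ} (h : IsXType A) :
    (hadamard * A * hadamardᴴ).IsDiag := by
  obtain ⟨h1, h2⟩ := h
  intro a b hab
  cases a <;> cases b <;>
    simp [hadamard, Matrix.mul_apply, Matrix.conjTranspose_apply, h1, h2] at hab ⊢ <;> ring

/-- The images of `P ⊗ P` under conjugation with a controlled-NOT, for a Pauli letter `P`:
`1 ⊗ 1`, `X ⊗ 1`, `-X ⊗ Z` and `1 ⊗ Z`. -/
theorem Pauli.exists_cnot_conj (P : Pauli) : ∃ A B : Matrix Bool Bool ℂ,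
    IsXType A ∧ B.IsDiag ∧ ∀ xc xt yc yt : Bool,
      P.mat xc yc * P.mat (xor xt xc) (xor yt yc) = A xc yc * B xt yt := by
  cases P
  · refine ⟨1, 1, by simp [IsXType], Matrix.isDiag_one, ?_⟩
    intro xc xt yc yt
    cases xc <;> cases xt <;> cases yc <;> cases yt <;> simp [Pauli.mat]
  · refine ⟨Pauli.X.mat, 1, by simp [IsXType, Pauli.mat], Matrix.isDiag_one, ?_⟩
    intro xc xt yc yt
    cases xc <;> cases xt <;> cases yc <;> cases yt <;> simp [Pauli.mat]
  · refine ⟨-Pauli.X.mat, Pauli.Z.mat, by simp [IsXType, Pauli.mat],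
      Matrix.isDiag_diagonal _, ?_⟩
    intro xc xt yc yt
    cases xc <;> cases xt <;> cases yc <;> cases yt <;> simp [Pauli.mat]
  · refine ⟨1, Pauli.Z.mat, by simp [IsXType], Matrix.isDiag_diagonal _, ?_⟩
    intro xc xt yc yt
    cases xc <;> cases xt <;> cases yc <;> cases yt <;> simp [Pauli.mat]

section Bell

variable {ι : Type}

/-- The Bell measurement of pairwise disjoint pairs of qubits, all other qubits being measured
in the computational basis. -/
def bellPairsCircuit (ps : List (ι × ι)) : Circuit ι :=
  [ps.map fun p => Gate.CNOT p.1 p.2, (ps.map Prod.fst).map Gate.H]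

theorem bellPairsCircuit_valid {ps : List (ι × ι)}
    (hps : (ps.flatMap fun p => [p.1, p.2]).Nodup) (hfst : (ps.map Prod.fst).Nodup) :
    (bellPairsCircuit ps).Valid := by
  intro l hl
  simp only [bellPairsCircuit, List.mem_cons, List.not_mem_nil, or_false] at hl
  rcases hl with rfl | rfl
  · rw [List.flatMap_map]
    exact hps
  · rw [List.flatMap_map]
    simpa [Gate.qubits, Function.comp_def] using hfst

variable [Fintype ι] [DecidableEq ι]

theorem cnot_conj_tensorOp {c t : ι} (h : c ≠ t) (M : ι → Matrix Bool Bool ℂ)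
    {A B : Matrix Bool Bool ℂ}
    (hAB : ∀ xc xt yc yt : Bool,
      M c xc yc * M t (xor xt xc) (xor yt yc) = A xc yc * B xt yt) :
    (Gate.CNOT c t).op * tensorOp M * (Gate.CNOT c t).opᴴ =
      tensorOp (Function.update (Function.update M c A) t B) := by
  ext x y
  rw [cnot_conj_apply h]
  simp only [tensorOp, Matrix.of_apply]
  have hc : c ∈ (Finset.univ : Finset ι).erase t := by simp [h]
  rw [← Finset.mul_prod_erase _ _ (Finset.mem_univ t), ← Finset.mul_prod_erase _ _ hc,
    ← Finset.mul_prod_erase (Finset.univ : Finset ι) _ (Finset.mem_univ t),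
    ← Finset.mul_prod_erase _ _ hc, ← mul_assoc, ← mul_assoc]
  congr 1
  · have := hAB (x c) (x t) (y c) (y t)
    simp only [cnotFun, Function.update_self, ne_eq, h, not_false_eq_true,
      Function.update_of_ne]
    rw [mul_comm, this, mul_comm]
  · refine Finset.prod_congr rfl fun q hq => ?_
    simp only [Finset.mem_erase, Finset.mem_univ, and_true] at hq
    simp [cnotFun, hq.1, hq.2]

/-- A layer of controlled-NOTs maps a Pauli string with equal letters at the two ends of every
gate to a product of operators of `X`-type at the controls and diagonal ones at the targets. -/
theorem exists_cnots_conj (ps : List (ι × ι))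
    (hps : (ps.flatMap fun p => [p.1, p.2]).Nodup) (M : ι → Matrix Bool Bool ℂ)
    (hM : ∀ p ∈ ps, ∃ P : Pauli, M p.1 = P.mat ∧ M p.2 = P.mat) :
    ∃ M' : ι → Matrix Bool Bool ℂ,
      gatesOp (ps.map fun p => Gate.CNOT p.1 p.2) * tensorOp M *
        (gatesOp (ps.map fun p => Gate.CNOT p.1 p.2))ᴴ = tensorOp M' ∧
      (∀ p ∈ ps, IsXType (M' p.1) ∧ (M' p.2).IsDiag) ∧
      ∀ q, q ∉ (ps.flatMap fun p => [p.1, p.2]) → M' q = M q := by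
  induction ps generalizing M with
  | nil => exact ⟨M, by simp [gatesOp], by simp, by simp⟩
  | cons p ps ih =>
    rw [List.flatMap_cons, List.nodup_append] at hps
    obtain ⟨hp, hps, hdisj⟩ := hps
    have hct : p.1 ≠ p.2 := by simpa using hp
    obtain ⟨P, hP1, hP2⟩ := hM p List.mem_cons_self
    obtain ⟨A, B, hA, hB, hAB⟩ := P.exists_cnot_conj
    have h1 : p.1 ∉ ps.flatMap fun p => [p.1, p.2] :=
      fun h => hdisj p.1 (by simp) p.1 h rfl
    have h2 : p.2 ∉ ps.flatMap fun p => [p.1, p.2] :=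
      fun h => hdisj p.2 (by simp) p.2 h rfl
    have hout : ∀ p' ∈ ps, (p'.1 ≠ p.1 ∧ p'.1 ≠ p.2) ∧ p'.2 ≠ p.1 ∧ p'.2 ≠ p.2 := by
      intro p' hp'
      refine ⟨⟨?_, ?_⟩, ?_, ?_⟩ <;> intro h
      · exact h1 (List.mem_flatMap.mpr ⟨p', hp', by simp [h]⟩)
      · exact h2 (List.mem_flatMap.mpr ⟨p', hp', by simp [h]⟩)
      · exact h1 (List.mem_flatMap.mpr ⟨p', hp', by simp [h]⟩)
      · exact h2 (List.mem_flatMap.mpr ⟨p', hp', by simp [h]⟩)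
    obtain ⟨M', hM', hps', hoff⟩ := ih hps
      (Function.update (Function.update M p.1 A) p.2 B) (by
        intro p' hp'
        obtain ⟨⟨ha, hb⟩, hc, hd⟩ := hout p' hp'
        simpa [ha, hb, hc, hd] using hM p' (List.mem_cons_of_mem _ hp'))
    refine ⟨M', ?_, ?_, ?_⟩
    · rw [List.map_cons, gatesOp_cons_conj, cnot_conj_tensorOp hct M (by rwa [hP1, hP2]), hM']
    · intro p' hp'
      rcases List.mem_cons.mp hp' with rfl | hp'
      · rw [hoff _ h1, hoff _ h2]
        simpa [hct] using ⟨hA, hB⟩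
      · exact hps' p' hp'
    · intro q hq
      simp only [List.flatMap_cons, List.mem_append, List.mem_cons, List.not_mem_nil, or_false,
        not_or] at hq
      rw [hoff q hq.2]
      simp [hq.1.1, hq.1.2]

/-- A layer of Hadamard gates diagonalises a tensor product whose factors are of `X`-type where
the gates act, and diagonal elsewhere. -/
theorem hadamards_conj_isDiag (qs : List ι) (hqs : qs.Nodup) (M : ι → Matrix Bool Bool ℂ)
    (hX : ∀ q ∈ qs, IsXType (M q)) (hD : ∀ q, q ∉ qs → (M q).IsDiag) :
    (gatesOp (qs.map Gate.H) * tensorOp M * (gatesOp (qs.map Gate.H))ᴴ).IsDiag := by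
  induction qs generalizing M with
  | nil => simpa [gatesOp] using tensorOp_isDiag fun q => hD q (by simp)
  | cons r qs ih =>
    rw [List.nodup_cons] at hqs
    have hH : (Gate.H r).op = applyAt r hadamard := rfl
    rw [List.map_cons, gatesOp_cons_conj, hH, applyAt_conj]
    refine ih hqs.2 _ (fun q hq => ?_) fun q hq => ?_
    · have : q ≠ r := fun h => hqs.1 (h ▸ hq)
      simpa [this] using hX q (List.mem_cons_of_mem _ hq)
    · by_cases h : q = r
      · subst h
        simpa using (hX q List.mem_cons_self).hadamard_conj
      · simpa [h] using hD q (by simp [h, hq])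

theorem bellPairsCircuit_measures {ps : List (ι × ι)}
    (hps : (ps.flatMap fun p => [p.1, p.2]).Nodup) (hfst : (ps.map Prod.fst).Nodup)
    (M : ι → Matrix Bool Bool ℂ)
    (hM : ∀ p ∈ ps, ∃ P : Pauli, M p.1 = P.mat ∧ M p.2 = P.mat)
    (hD : ∀ q, q ∉ (ps.flatMap fun p => [p.1, p.2]) → (M q).IsDiag) :
    (bellPairsCircuit ps).Measures (tensorOp M) := by
  obtain ⟨M', hM', hpairs, hoff⟩ := exists_cnots_conj ps hps M hM
  have hop : (bellPairsCircuit ps).op =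
      gatesOp ((ps.map fun p => Gate.CNOT p.1 p.2) ++ (ps.map Prod.fst).map Gate.H) := by
    simp [Circuit.op, bellPairsCircuit]
  rw [Circuit.Measures, hop, gatesOp_append_conj, hM']
  refine hadamards_conj_isDiag _ hfst _ (fun q hq => ?_) fun q hq => ?_
  · obtain ⟨p, hp, rfl⟩ := List.mem_map.mp hq
    exact (hpairs p hp).1
  · by_cases h : q ∈ ps.flatMap fun p => [p.1, p.2]
    · obtain ⟨p, hp, hqp⟩ := List.mem_flatMap.mp h
      simp only [List.mem_cons, List.not_mem_nil, or_false] at hqp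
      rcases hqp with rfl | rfl
      · exact absurd (List.mem_map_of_mem hp) hq
      · exact (hpairs p hp).2
    · rw [hoff q h]
      exact hD q h

end Bell

/-! ### The measurement circuits of the protocol -/

section Cross

variable {n : ℕ}

/-- The pairs formed by qubit `p.1` of the first copy and qubit `p.2` of the second. -/
def crossPairs (ps : List (Fin n × Fin n)) : List ((Fin 2 × Fin n) × (Fin 2 × Fin n)) :=
  ps.map fun p => ((0, p.1), (1, p.2))

theorem mem_crossPairs_qubits {ps : List (Fin n × Fin n)} {q : Fin 2 × Fin n} :
    q ∈ ((crossPairs ps).flatMap fun p => [p.1, p.2]) ↔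
      ∃ p ∈ ps, q = (0, p.1) ∨ q = (1, p.2) := by
  simp [crossPairs, List.mem_flatMap]

theorem crossPairs_nodup {ps : List (Fin n × Fin n)} (h1 : (ps.map Prod.fst).Nodup)
    (h2 : (ps.map Prod.snd).Nodup) :
    ((crossPairs ps).flatMap fun p => [p.1, p.2]).Nodup := by
  induction ps with
  | nil => simp [crossPairs]
  | cons p ps ih =>
    rw [List.map_cons, List.nodup_cons] at h1 h2
    have hc : ((crossPairs (p :: ps)).flatMap fun p => [p.1, p.2]) =
        [(0, p.1), (1, p.2)] ++ (crossPairs ps).flatMap fun p => [p.1, p.2] := by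
      simp [crossPairs]
    rw [hc, List.nodup_append]
    refine ⟨by simp, ih h1.2 h2.2, ?_⟩
    rintro a ha b hb rfl
    obtain ⟨p', hp', h⟩ := mem_crossPairs_qubits.mp hb
    simp only [List.mem_cons, List.not_mem_nil, or_false] at ha
    rcases ha with rfl | rfl
    · refine h1.1 (List.mem_map.mpr ⟨p', hp', ?_⟩)
      simpa [eq_comm] using h
    · refine h2.1 (List.mem_map.mpr ⟨p', hp', ?_⟩)
      simpa [eq_comm] using h

theorem crossPairs_fst_nodup {ps : List (Fin n × Fin n)} (h1 : (ps.map Prod.fst).Nodup) :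
    ((crossPairs ps).map Prod.fst).Nodup := by
  have : (crossPairs ps).map Prod.fst = (ps.map Prod.fst).map fun j => ((0 : Fin 2), j) := by
    simp [crossPairs, Function.comp_def]
  rw [this]
  exact h1.map fun a b h => (Prod.mk.inj h).2

theorem bellPairsCircuit_crossPairs_valid {ps : List (Fin n × Fin n)}
    (h1 : (ps.map Prod.fst).Nodup) (h2 : (ps.map Prod.snd).Nodup) :
    (bellPairsCircuit (crossPairs ps)).Valid :=
  bellPairsCircuit_valid (crossPairs_nodup h1 h2) (crossPairs_fst_nodup h1)

/-- Bell measurements on pairs at which the Pauli letters of two Majorana operators agree, and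
which include the pair of their last letters, measure the product of the two. -/
theorem bellPairsCircuit_crossPairs_measures {ps : List (Fin n × Fin n)}
    (h1 : (ps.map Prod.fst).Nodup) (h2 : (ps.map Prod.snd).Nodup) (a : Axis) {i j : Fin n}
    (hij : (i, j) ∈ ps) (h : ∀ p ∈ ps, majoranaLetter a i p.1 = majoranaLetter a j p.2) :
    (bellPairsCircuit (crossPairs ps)).Measures (pairOp a i j) := by
  rw [pairOp_eq]
  refine bellPairsCircuit_measures (crossPairs_nodup h1 h2) (crossPairs_fst_nodup h1) _ ?_ ?_
  · intro p' hp'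
    obtain ⟨p, hp, rfl⟩ := List.mem_map.mp hp'
    exact ⟨majoranaLetter a i p.1, by simp, by simp [h p hp]⟩
  · rintro ⟨c, q⟩ hq
    rw [mem_crossPairs_qubits] at hq
    push Not at hq
    have := hq _ hij
    apply majoranaLetter_isDiag
    fin_cases c <;> simpa using this

theorem bellCircuit_eq : bellCircuit n =
    bellPairsCircuit (crossPairs ((List.finRange n).map fun j => (j, j))) := by
  simp [bellCircuit, bellPairsCircuit, crossPairs, Function.comp_def]

theorem chainCircuit_eq (L : List (Fin n)) :
    chainCircuit L = bellPairsCircuit (crossPairs (links L)) := by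
  simp [chainCircuit, bellPairsCircuit, crossPairs, Function.comp_def]

theorem bellCircuit_valid : (bellCircuit n).Valid := by
  rw [bellCircuit_eq]
  apply bellPairsCircuit_crossPairs_valid <;>
    simpa [Function.comp_def] using List.nodup_finRange n

theorem bellCircuit_measures (a : Axis) (j : Fin n) :
    (bellCircuit n).Measures (pairOp a j j) := by
  rw [bellCircuit_eq]
  apply bellPairsCircuit_crossPairs_measures
  · simpa [Function.comp_def] using List.nodup_finRange n
  · simpa [Function.comp_def] using List.nodup_finRange n
  · simp
  · intro p hp
    obtain ⟨k, -, rfl⟩ := List.mem_map.mp hp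
    rfl

theorem links_fst_nodup {L : List (Fin n)} (hL : L.Nodup) : ((links L).map Prod.fst).Nodup := by
  refine List.Sublist.nodup ?_ hL
  have : (links L).map Prod.fst = L.dropLast :=
    List.ext_getElem (by simp [links]) (by simp [links])
  rw [this]
  exact List.dropLast_sublist L

theorem links_snd_nodup {L : List (Fin n)} (hL : L.Nodup) : ((links L).map Prod.snd).Nodup := by
  refine List.Sublist.nodup ?_ hL
  rw [links, List.map_snd_zip (by simp)]
  exact List.tail_sublist L

theorem mem_links {L : List (Fin n)} {p : Fin n × Fin n} (hp : p ∈ links L) :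
    ∃ (k : ℕ) (hk : k + 1 < L.length), L[k] = p.1 ∧ L[k + 1] = p.2 := by
  obtain ⟨k, hk, rfl⟩ := List.mem_iff_getElem.mp hp
  simp only [links, List.length_zip, List.length_tail] at hk
  exact ⟨k, by omega, by simp [links]⟩

/-- Along an increasing chain, the left ends of the links are ordered in the same way as the
right ends. -/
theorem links_letter_eq {L : List (Fin n)} (hL : L.Pairwise (· < ·)) (a : Axis)
    {p q : Fin n × Fin n} (hp : p ∈ links L) (hq : q ∈ links L) :
    majoranaLetter a q.1 p.1 = majoranaLetter a q.2 p.2 := by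
  obtain ⟨k, hk, hk1, hk2⟩ := mem_links hp
  obtain ⟨l, hl, hl1, hl2⟩ := mem_links hq
  have hmono : ∀ (u v : ℕ) (hu : u < L.length) (hv : v < L.length), L[u] < L[v] ↔ u < v := by
    intro u v hu hv
    have hs : StrictMono L.get := hL.sortedLT.strictMono_get
    exact hs.lt_iff_lt (a := ⟨u, hu⟩) (b := ⟨v, hv⟩)
  have hinj : ∀ (u v : ℕ) (hu : u < L.length) (hv : v < L.length), L[u] = L[v] ↔ u = v := by
    intro u v hu hv
    exact List.Nodup.getElem_inj_iff (hL.imp ne_of_lt)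
  rw [majoranaLetter, majoranaLetter, ← hk1, ← hk2, ← hl1, ← hl2]
  simp only [hmono, hinj, Nat.add_lt_add_iff_right, Nat.add_right_cancel_iff]

theorem chainCircuit_valid {L : List (Fin n)} (hL : L.Nodup) : (chainCircuit L).Valid := by
  rw [chainCircuit_eq]
  exact bellPairsCircuit_crossPairs_valid (links_fst_nodup hL) (links_snd_nodup hL)

theorem chainCircuit_measures {L : List (Fin n)} (hL : L.Pairwise (· < ·)) (a : Axis)
    {p : Fin n × Fin n} (hp : p ∈ links L) : (chainCircuit L).Measures (pairOp a p.1 p.2) := by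
  have hnd : L.Nodup := hL.imp ne_of_lt
  rw [chainCircuit_eq]
  exact bellPairsCircuit_crossPairs_measures (links_fst_nodup hnd) (links_snd_nodup hnd) a hp
    fun q hq => links_letter_eq hL a hq hp

theorem firstCircuit_valid (a : Axis) (j : Fin n) : (firstCircuit a j).Valid := by
  cases a <;> simp [firstCircuit, Circuit.Valid, Gate.qubits]

theorem firstCircuit_measures (a : Axis) (j : Fin n) :
    (firstCircuit a j).Measures (copyTensor fun _ => majorana a j) := by
  have hH : (Gate.H ((0 : Fin 1), j)).op = applyAt (0, j) hadamard := rfl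
  have hS : (Gate.Sdg ((0 : Fin 1), j)).op = applyAt (0, j) phaseInv := rfl
  have hne : ∀ q : Fin 1 × Fin n, q ≠ (0, j) → q.2 ≠ j := by
    rintro ⟨c, q⟩ h rfl
    exact h (by rw [Subsingleton.elim c 0])
  simp only [majorana_eq]
  rw [copyTensor_tensorOp (k := 1) fun _ q => (majoranaLetter a j q).mat, Circuit.Measures,
    Circuit.op]
  cases a with
  | x =>
    refine hadamards_conj_isDiag [(0, j)] (by simp) _ ?_ ?_
    · simp [majoranaLetter, Axis.pauli, IsXType, Pauli.mat]
    · intro q hq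
      exact majoranaLetter_isDiag _ (hne q (by simpa using hq))
  | y =>
    have : (firstCircuit Axis.y j).flatten = Gate.Sdg (0, j) :: [(0, j)].map Gate.H := rfl
    rw [this, gatesOp_cons_conj, hS, applyAt_conj]
    refine hadamards_conj_isDiag [(0, j)] (by simp) _ ?_ ?_
    -- the inverse phase gate turns `Y` into `X`
    · simp [majoranaLetter, Axis.pauli, IsXType, Pauli.mat, phaseInv, Matrix.mul_apply,
        Matrix.diagonal_apply]
    · intro q hq
      have hq' : q ≠ (0, j) := by simpa using hq
      simpa [hq'] using majoranaLetter_isDiag _ (hne q hq')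

end Cross

/-! ### Concentration of empirical means -/

section Concentration

variable {β : Type} [Fintype β]

theorem sum_prod_eq_one {p : β → ℝ} (hp1 : ∑ b, p b = 1) (N : ℕ) :
    ∑ w : Fin N → β, ∏ s, p (w s) = 1 := by
  rw [← Fintype.sum_pow, hp1, one_pow]

/-- A centred variable with values in `[-2, 2]` is sub-Gaussian for small `t`, because
`exp y ≤ 1 + y + y ^ 2` for `|y| ≤ 1`. -/
theorem sum_mul_exp_le {p Y : β → ℝ} (hp : ∀ b, 0 ≤ p b) (hp1 : ∑ b, p b = 1)
    (hY : ∀ b, |Y b| ≤ 2) (hY0 : ∑ b, p b * Y b = 0) {t : ℝ} (ht : 0 ≤ t) (ht' : t ≤ 1 / 2) :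
    ∑ b, p b * Real.exp (t * Y b) ≤ Real.exp (4 * t ^ 2) := by
  have hpt : ∀ b, Real.exp (t * Y b) ≤ 1 + t * Y b + 4 * t ^ 2 := by
    intro b
    have h1 : |t * Y b| ≤ 1 := by
      rw [abs_mul, abs_of_nonneg ht]
      nlinarith [hY b, abs_nonneg (Y b)]
    have h2 := (abs_le.mp (Real.abs_exp_sub_one_sub_id_le h1)).2
    have h3 : (Y b) ^ 2 ≤ 4 := by
      have := sq_abs (Y b)
      nlinarith [hY b, abs_nonneg (Y b)]
    nlinarith [mul_le_mul_of_nonneg_left h3 (sq_nonneg t)]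
  calc ∑ b, p b * Real.exp (t * Y b)
      ≤ ∑ b, p b * (1 + t * Y b + 4 * t ^ 2) :=
        Finset.sum_le_sum fun b _ => mul_le_mul_of_nonneg_left (hpt b) (hp b)
    _ = ∑ b, p b + t * ∑ b, p b * Y b + (∑ b, p b) * (4 * t ^ 2) := by
        rw [Finset.mul_sum, Finset.sum_mul, ← Finset.sum_add_distrib, ← Finset.sum_add_distrib]
        exact Finset.sum_congr rfl fun b _ => by ring
    _ = 4 * t ^ 2 + 1 := by rw [hp1, hY0]; ring
    _ ≤ Real.exp (4 * t ^ 2) := Real.add_one_le_exp _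

/-- One-sided Hoeffding inequality for `N` independent samples of a centred variable with values
in `[-2, 2]`. -/
theorem sum_prod_upper_tail_le {p Y : β → ℝ} (hp : ∀ b, 0 ≤ p b) (hp1 : ∑ b, p b = 1)
    (hY : ∀ b, |Y b| ≤ 2) (hY0 : ∑ b, p b * Y b = 0) (N : ℕ) {η : ℝ} (hη : 0 ≤ η)
    (hη' : η ≤ 4) [DecidablePred fun w : Fin N → β => N * η ≤ ∑ s, Y (w s)] :
    ∑ w : Fin N → β with N * η ≤ ∑ s, Y (w s), ∏ s, p (w s) ≤
      Real.exp (-(N * (η ^ 2 / 16))) := by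
  -- `t = η / 8` minimises the exponent `4 * t ^ 2 - t * η` of the Chernoff bound
  set t : ℝ := η / 8 with ht
  have hnn : ∀ w : Fin N → β, 0 ≤ ∏ s, p (w s) := fun w =>
    Finset.prod_nonneg fun s _ => hp _
  calc ∑ w : Fin N → β with N * η ≤ ∑ s, Y (w s), ∏ s, p (w s)
      ≤ ∑ w : Fin N → β with N * η ≤ ∑ s, Y (w s),
          (∏ s, p (w s)) * Real.exp (t * (∑ s, Y (w s) - N * η)) := by
        refine Finset.sum_le_sum fun w hw => le_mul_of_one_le_right (hnn w) ?_
        rw [Real.one_le_exp_iff]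
        exact mul_nonneg (by positivity) (sub_nonneg.mpr (Finset.mem_filter.mp hw).2)
    _ ≤ ∑ w : Fin N → β, (∏ s, p (w s)) * Real.exp (t * (∑ s, Y (w s) - N * η)) :=
        Finset.sum_le_sum_of_subset_of_nonneg (Finset.filter_subset _ _) fun w _ _ =>
          mul_nonneg (hnn w) (Real.exp_pos _).le
    _ = (∑ b, p b * Real.exp (t * Y b)) ^ N * Real.exp (-(t * (N * η))) := by
        rw [Fintype.sum_pow, Finset.sum_mul]
        refine Finset.sum_congr rfl fun w _ => ?_
        rw [Finset.prod_mul_distrib, ← Real.exp_sum, mul_assoc, ← Real.exp_add,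
          ← Finset.mul_sum]
        congr 2
        ring
    _ ≤ Real.exp (4 * t ^ 2) ^ N * Real.exp (-(t * (N * η))) := by
        gcongr
        · exact Finset.sum_nonneg fun b _ => mul_nonneg (hp b) (Real.exp_pos _).le
        · exact sum_mul_exp_le hp hp1 hY hY0 (by positivity) (by linarith)
    _ = Real.exp (-(N * (η ^ 2 / 16))) := by
        rw [← Real.exp_nat_mul, ← Real.exp_add]
        congr 1
        rw [ht]
        ring

open Classical in
/-- Two-sided Hoeffding inequality for `N` independent samples of a variable with values in
`[-1, 1]` and expectation `μ`. -/
theorem sum_prod_two_sided_tail_le {p X : β → ℝ} (hp : ∀ b, 0 ≤ p b) (hp1 : ∑ b, p b = 1)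
    (hX : ∀ b, |X b| ≤ 1) {μ : ℝ} (hμ : ∑ b, p b * X b = μ) (N : ℕ) {η : ℝ} (hη : 0 ≤ η)
    (hη' : η ≤ 4) :
    ∑ w : Fin N → β with ¬ |(∑ s, X (w s)) / N - μ| < η, ∏ s, p (w s) ≤
      2 * Real.exp (-(N * (η ^ 2 / 16))) := by
  have hnn : ∀ w : Fin N → β, 0 ≤ ∏ s, p (w s) := fun w =>
    Finset.prod_nonneg fun s _ => hp _
  have hμ1 : |μ| ≤ 1 := by
    rw [← hμ]
    refine (Finset.abs_sum_le_sum_abs _ _).trans (le_trans ?_ hp1.le)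
    refine Finset.sum_le_sum fun b _ => ?_
    rw [abs_mul, abs_of_nonneg (hp b)]
    exact mul_le_of_le_one_right (hp b) (hX b)
  have hY : ∀ b, |X b - μ| ≤ 2 := fun b =>
    (abs_sub _ _).trans (by linarith [hX b])
  have hY0 : ∑ b, p b * (X b - μ) = 0 := by
    simp only [mul_sub, Finset.sum_sub_distrib, ← Finset.sum_mul, hμ, hp1, one_mul, sub_self]
  have h1 := sum_prod_upper_tail_le hp hp1 hY hY0 N hη hη'
  have h2 := sum_prod_upper_tail_le (Y := fun b => -(X b - μ)) hp hp1
    (fun b => by rw [abs_neg]; exact hY b)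
    (by simp only [mul_neg, Finset.sum_neg_distrib, hY0, neg_zero]) N hη hη'
  have hsub : (Finset.univ.filter fun w : Fin N → β => ¬ |(∑ s, X (w s)) / N - μ| < η) ⊆
      (Finset.univ.filter fun w : Fin N → β => N * η ≤ ∑ s, (X (w s) - μ)) ∪
      (Finset.univ.filter fun w : Fin N → β => N * η ≤ ∑ s, -(X (w s) - μ)) := by
    intro w hw
    simp only [Finset.mem_filter, Finset.mem_univ, true_and, not_lt, Finset.mem_union] at hw ⊢
    have hN : ∑ s, (X (w s) - μ) = N * ((∑ s, X (w s)) / N - μ) := by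
      rcases Nat.eq_zero_or_pos N with rfl | hN
      · simp
      · rw [Finset.sum_sub_distrib, mul_sub, mul_div_cancel₀ _ (by positivity)]
        simp
    rw [Finset.sum_neg_distrib, hN, ← mul_neg]
    rcases le_abs.mp hw with h | h
    · exact Or.inl (mul_le_mul_of_nonneg_left h (Nat.cast_nonneg N))
    · exact Or.inr (mul_le_mul_of_nonneg_left h (Nat.cast_nonneg N))
  refine (Finset.sum_le_sum_of_subset_of_nonneg hsub fun w _ _ => hnn w).trans ?_
  refine (le_add_of_nonneg_right (Finset.sum_nonneg fun w _ => hnn w)).trans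
    (Finset.sum_union_inter.trans_le ?_)
  linarith

open Classical in
/-- With large probability, finitely many empirical means are simultaneously close to their
expectations. -/
theorem le_sum_prod_forall_close {κ : Type} [Fintype κ] {p : β → ℝ} {X : κ → β → ℝ}
    {μ : κ → ℝ} (hp : ∀ b, 0 ≤ p b) (hp1 : ∑ b, p b = 1) (hX : ∀ k b, |X k b| ≤ 1)
    (hμ : ∀ k, ∑ b, p b * X k b = μ k) (N : ℕ) {η : ℝ} (hη : 0 ≤ η) (hη' : η ≤ 4) :
    1 - Fintype.card κ * (2 * Real.exp (-(N * (η ^ 2 / 16)))) ≤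
      ∑ w : Fin N → β with ∀ k, |(∑ s, X k (w s)) / N - μ k| < η, ∏ s, p (w s) := by
  have hnn : ∀ w : Fin N → β, 0 ≤ ∏ s, p (w s) := fun w =>
    Finset.prod_nonneg fun s _ => hp _
  have hsplit := Finset.sum_filter_add_sum_filter_not (Finset.univ : Finset (Fin N → β))
    (fun w => ∀ k, |(∑ s, X k (w s)) / N - μ k| < η) fun w => ∏ s, p (w s)
  rw [sum_prod_eq_one hp1] at hsplit
  have hbad : ∑ w : Fin N → β with ¬ ∀ k, |(∑ s, X k (w s)) / N - μ k| < η, ∏ s, p (w s) ≤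
      Fintype.card κ * (2 * Real.exp (-(N * (η ^ 2 / 16)))) := by
    calc _ ≤ ∑ k, ∑ w : Fin N → β with ¬ |(∑ s, X k (w s)) / N - μ k| < η,
          ∏ s, p (w s) := by
          simp only [Finset.sum_filter]
          rw [Finset.sum_comm]
          refine Finset.sum_le_sum fun w _ => ?_
          have hterm : ∀ k ∈ Finset.univ,
              0 ≤ if ¬ |(∑ s, X k (w s)) / N - μ k| < η then ∏ s, p (w s) else 0 := by
            intro k _
            split_ifs
            · exact le_rfl
            · exact hnn w
          by_cases h : ∀ k, |(∑ s, X k (w s)) / N - μ k| < η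
          · rw [if_neg (not_not.mpr h)]
            exact Finset.sum_nonneg hterm
          · rw [if_pos h]
            obtain ⟨k, hk⟩ := not_forall.mp h
            exact (if_pos hk).symm.le.trans (Finset.single_le_sum hterm (Finset.mem_univ k))
      _ ≤ ∑ _k : κ, 2 * Real.exp (-(N * (η ^ 2 / 16))) :=
          Finset.sum_le_sum fun k _ =>
            sum_prod_two_sided_tail_le hp hp1 (hX k) (hμ k) N hη hη'
      _ = _ := by simp
  linarith

end Concentration

/-! ### Outcome statistics of a circuit -/

section Born

variable {ι : Type} [Fintype ι] [DecidableEq ι] {C : Circuit ι} {σ : QOp ι}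

theorem Circuit.born_nonneg (C : Circuit ι) (hσ : IsState σ) (b : Bits ι) :
    0 ≤ C.born σ b := by
  have h := (hσ.1.mul_mul_conjTranspose_same C.op).diag_nonneg (i := b)
  exact (Complex.le_def.mp h).1

theorem Circuit.Valid.sum_born (hC : C.Valid) (hσ : IsState σ) : ∑ b, C.born σ b = 1 := by
  have h : (C.op * σ * C.opᴴ).trace = 1 := by
    rw [Matrix.trace_mul_cycle, hC.op_unitary, Matrix.one_mul, hσ.2]
  rw [← Complex.one_re, ← h, Matrix.trace, Complex.re_sum]
  rfl

/-- In the basis of a circuit that measures it, an observable with square one is diagonal with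
entries `1` and `-1`. -/
theorem Circuit.Measures.apply_self_eq (hC : C.Valid) {O : QOp ι} (hO : C.Measures O)
    (h1 : O * O = 1) (b : Bits ι) :
    (C.op * O * C.opᴴ) b b = 1 ∨ (C.op * O * C.opᴴ) b b = -1 := by
  have hU := hC.op_unitary
  have hU' := mul_eq_one_comm.mp hU
  have hsq : (C.op * O * C.opᴴ) * (C.op * O * C.opᴴ) = 1 := by
    calc _ = C.op * O * (C.opᴴ * C.op) * O * C.opᴴ := by simp only [Matrix.mul_assoc]
      _ = C.op * (O * O) * C.opᴴ := by rw [hU, Matrix.mul_one]; simp only [Matrix.mul_assoc]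
      _ = 1 := by rw [h1, Matrix.mul_one, hU']
  rw [← hO.diagonal_diag, Matrix.diagonal_mul_diagonal, ← Matrix.diagonal_one,
    Matrix.diagonal_eq_diagonal_iff] at hsq
  exact mul_self_eq_one_iff.mp (hsq b)

theorem Circuit.Measures.abs_readout_le (hC : C.Valid) {O : QOp ι} (hO : C.Measures O)
    (h1 : O * O = 1) (b : Bits ι) : |C.readout O b| ≤ 1 := by
  rcases hO.apply_self_eq hC h1 b with h | h <;> simp [Circuit.readout, h]

theorem Circuit.Measures.sum_born_mul_readout (hC : C.Valid) {O : QOp ι} (hO : C.Measures O)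
    (h1 : O * O = 1) (σ : QOp ι) :
    ∑ b, C.born σ b * C.readout O b = expectation σ O := by
  have hU := hC.op_unitary
  have h : (σ * O).trace = ((C.op * σ * C.opᴴ) * (C.op * O * C.opᴴ)).trace := by
    calc (σ * O).trace = ((C.opᴴ * C.op) * (σ * O)).trace := by rw [hU, Matrix.one_mul]
      _ = (C.op * (σ * O) * C.opᴴ).trace := by
          rw [Matrix.trace_mul_cycle C.op]
      _ = (C.op * σ * (C.opᴴ * C.op) * O * C.opᴴ).trace := by
          rw [hU, Matrix.mul_one]; simp only [Matrix.mul_assoc]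
      _ = _ := by simp only [Matrix.mul_assoc]
  rw [expectation, h, ← hO.diagonal_diag, Matrix.trace, Complex.re_sum]
  refine Finset.sum_congr rfl fun b _ => ?_
  rw [Matrix.diag_apply, Matrix.mul_diagonal, Matrix.diag_apply, Circuit.born, Circuit.readout]
  rcases hO.apply_self_eq hC h1 b with h | h <;> simp [h]

theorem abs_expectation_le (hC : C.Valid) {O : QOp ι} (hO : C.Measures O) (h1 : O * O = 1)
    (hσ : IsState σ) : |expectation σ O| ≤ 1 := by
  rw [← hO.sum_born_mul_readout hC h1 σ, ← hC.sum_born hσ]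
  refine (Finset.abs_sum_le_sum_abs _ _).trans (Finset.sum_le_sum fun b _ => ?_)
  rw [abs_mul, abs_of_nonneg (C.born_nonneg hσ b)]
  exact mul_le_of_le_one_right (C.born_nonneg hσ b) (hO.abs_readout_le hC h1 b)

open Classical in
/-- With large probability, the empirical means of finitely many observables measured by the
same circuit are simultaneously close to their expectation values. -/
theorem le_sum_born_forall_close (hC : C.Valid) (hσ : IsState σ) {κ : Type} [Fintype κ]
    {O : κ → QOp ι} (hO : ∀ k, C.Measures (O k)) (h1 : ∀ k, O k * O k = 1) (N : ℕ) {η : ℝ}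
    (hη : 0 ≤ η) (hη' : η ≤ 4) :
    1 - Fintype.card κ * (2 * Real.exp (-(N * (η ^ 2 / 16)))) ≤
      ∑ w : Fin N → Bits ι with ∀ k, |C.mean (O k) w - expectation σ (O k)| < η,
        ∏ s, C.born σ (w s) :=
  le_sum_prod_forall_close (C.born_nonneg hσ) (hC.sum_born hσ)
    (fun k => (hO k).abs_readout_le hC (h1 k))
    (fun k => (hO k).sum_born_mul_readout hC (h1 k) σ) N hη hη'

end Born

/-! ### Expectation values on several copies -/

section Expectation

variable {n : ℕ} {ρ : QOp (Fin n)}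

theorem expectation_copyTensor_one (ρ O : QOp (Fin n)) :
    expectation (copyTensor fun _ : Fin 1 => ρ) (copyTensor fun _ => O) = expectation ρ O := by
  simp [expectation, copyTensor_mul, trace_copyTensor]

theorem im_trace_mul_majorana (hρ : IsState ρ) (a : Axis) (j : Fin n) :
    (ρ * majorana a j).trace.im = 0 := by
  rw [← Complex.conj_eq_iff_im, starRingEnd_apply, ← Matrix.trace_conjTranspose,
    Matrix.conjTranspose_mul, majorana_conjTranspose, hρ.1.isHermitian.eq, Matrix.trace_mul_comm]

theorem expectation_pairOp (hρ : IsState ρ) (a : Axis) (i j : Fin n) :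
    expectation (copyTensor fun _ : Fin 2 => ρ) (pairOp a i j) =
      expectation ρ (majorana a i) * expectation ρ (majorana a j) := by
  simp [expectation, pairOp, copyTensor_mul, trace_copyTensor, im_trace_mul_majorana hρ]

theorem abs_expectation_majorana_le (hρ : IsState ρ) (a : Axis) (j : Fin n) :
    |expectation ρ (majorana a j)| ≤ 1 := by
  rw [← expectation_copyTensor_one]
  exact abs_expectation_le (firstCircuit_valid a j) (firstCircuit_measures a j)
    (by simp [copyTensor_mul, majorana_mul_self, copyTensor_one]) hρ.copyTensor

end Expectation

/-! ### Costs of the protocol -/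

section Cost

variable {n : ℕ} {R : Type}

theorem chainStep_valid (a : Axis) {L : List (Fin n)} (hL : L.Nodup) (N₂ N₃ : ℕ)
    {next : (Fin n → SignType) → Protocol n R} (h : ∀ s, (next s).Valid) :
    (chainStep a L N₂ N₃ next).Valid := by
  cases L with
  | nil => exact h _
  | cons r T =>
    exact ⟨firstCircuit_valid a r, fun _ => ⟨chainCircuit_valid hL, fun _ => h _⟩⟩

theorem chainStep_width_le (a : Axis) (L : List (Fin n)) (N₂ N₃ : ℕ)
    {next : (Fin n → SignType) → Protocol n R} (h : ∀ s, (next s).width ≤ 2) :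
    (chainStep a L N₂ N₃ next).width ≤ 2 := by
  cases L with
  | nil => exact h _
  | cons r T =>
    exact max_le one_le_two (Finset.sup_le fun _ _ =>
      max_le le_rfl (Finset.sup_le fun _ _ => h _))

theorem firstCircuit_depth_le (a : Axis) (j : Fin n) : (firstCircuit a j).depth ≤ 2 := by
  cases a <;> simp [firstCircuit, Circuit.depth]

theorem chainStep_depth_le (a : Axis) (L : List (Fin n)) (N₂ N₃ : ℕ)
    {next : (Fin n → SignType) → Protocol n R} (h : ∀ s, (next s).depth ≤ 2) :
    (chainStep a L N₂ N₃ next).depth ≤ 2 := by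
  cases L with
  | nil => exact h _
  | cons r T =>
    exact max_le (firstCircuit_depth_le a r) (Finset.sup_le fun _ _ =>
      max_le le_rfl (Finset.sup_le fun _ _ => h _))

theorem chainStep_circuits_le (a : Axis) (L : List (Fin n)) (N₂ N₃ : ℕ)
    {next : (Fin n → SignType) → Protocol n R} {m : ℕ} (h : ∀ s, (next s).circuits ≤ m) :
    (chainStep a L N₂ N₃ next).circuits ≤ 2 + m := by
  cases L with
  | nil => exact (h _).trans (by omega)
  | cons r T =>
    have : (chainStep a (r :: T) N₂ N₃ next).circuits ≤ 1 + (1 + m) :=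
      Nat.add_le_add_left (Finset.sup_le fun _ _ =>
        Nat.add_le_add_left (Finset.sup_le fun _ _ => h _) 1) 1
    omega

theorem chainStep_samples_le (a : Axis) (L : List (Fin n)) (N₂ N₃ : ℕ)
    {next : (Fin n → SignType) → Protocol n R} {m : ℕ} (h : ∀ s, (next s).samples ≤ m) :
    (chainStep a L N₂ N₃ next).samples ≤ N₂ + 2 * N₃ + m := by
  cases L with
  | nil => exact (h _).trans (by omega)
  | cons r T =>
    have : (chainStep a (r :: T) N₂ N₃ next).samples ≤ 1 * N₂ + (2 * N₃ + m) :=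
      Nat.add_le_add_left (Finset.sup_le fun _ _ =>
        Nat.add_le_add_left (Finset.sup_le fun _ _ => h _) _) _
    omega

theorem sort_pairwise_lt (s : Finset (Fin n)) : (s.sort (· ≤ ·)).Pairwise (· < ·) :=
  s.sortedLT_sort.pairwise

theorem chainedProtocol_valid (n : ℕ) (ε : ℝ) (N₁ N₂ N₃ : ℕ) :
    (chainedProtocol n ε N₁ N₂ N₃).Valid :=
  ⟨bellCircuit_valid, fun _ =>
    chainStep_valid _ (Finset.sort_nodup _ _) _ _ fun _ =>
      chainStep_valid _ (Finset.sort_nodup _ _) _ _ fun _ => trivial⟩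

theorem chainedProtocol_width_le (n : ℕ) (ε : ℝ) (N₁ N₂ N₃ : ℕ) :
    (chainedProtocol n ε N₁ N₂ N₃).width ≤ 2 :=
  max_le le_rfl (Finset.sup_le fun _ _ =>
    chainStep_width_le _ _ _ _ fun _ => chainStep_width_le _ _ _ _ fun _ => Nat.zero_le _)

theorem chainedProtocol_depth_le (n : ℕ) (ε : ℝ) (N₁ N₂ N₃ : ℕ) :
    (chainedProtocol n ε N₁ N₂ N₃).depth ≤ 2 :=
  max_le le_rfl (Finset.sup_le fun _ _ =>
    chainStep_depth_le _ _ _ _ fun _ => chainStep_depth_le _ _ _ _ fun _ => Nat.zero_le _)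

theorem chainedProtocol_circuits_le (n : ℕ) (ε : ℝ) (N₁ N₂ N₃ : ℕ) :
    (chainedProtocol n ε N₁ N₂ N₃).circuits ≤ 5 :=
  Nat.add_le_add_left (Finset.sup_le fun _ _ =>
    chainStep_circuits_le _ _ _ _ fun _ =>
      chainStep_circuits_le (m := 0) _ _ _ _ fun _ => le_rfl) 1

theorem chainedProtocol_samples_le (n : ℕ) (ε : ℝ) (N₁ N₂ N₃ : ℕ) :
    (chainedProtocol n ε N₁ N₂ N₃).samples ≤
      2 * N₁ + (N₂ + 2 * N₃ + (N₂ + 2 * N₃ + 0)) :=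
  Nat.add_le_add_left (Finset.sup_le fun _ _ =>
    chainStep_samples_le _ _ _ _ fun _ =>
      chainStep_samples_le (m := 0) _ _ _ _ fun _ => le_rfl) _

end Cost

/-! ### Signs along a chain -/

theorem sign_eq_of_abs_sub_lt {x y : ℝ} (h : |x - y| < |y|) :
    SignType.sign x = SignType.sign y := by
  rcases lt_trichotomy y 0 with hy | rfl | hy
  · rw [abs_of_neg hy, abs_lt] at h
    rw [sign_neg hy, sign_neg (by linarith)]
  · exact absurd h (by simp)
  · rw [abs_of_pos hy, abs_lt] at h
    rw [sign_pos hy, sign_pos (by linarith)]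

/-- The product of the signs at the links telescopes: each interior sign occurs twice. -/
theorem chainSign_eq {n : ℕ} {e : Fin n → ℝ} {p₃ : Fin n × Fin n → ℝ} (r : Fin n)
    (T : List (Fin n)) (p₂ : ℝ) (hL : (r :: T).Pairwise (· < ·)) (he : ∀ j ∈ r :: T, e j ≠ 0)
    (h₂ : SignType.sign p₂ = SignType.sign (e r))
    (h₃ : ∀ p ∈ links (r :: T), SignType.sign (p₃ p) = SignType.sign (e p.1 * e p.2))
    {j : Fin n} (hj : j ∈ r :: T) :
    chainSign (r :: T) p₂ p₃ j = SignType.sign (e j) := by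
  induction T generalizing r p₂ with
  | nil =>
    obtain rfl : j = r := by simpa using hj
    simpa [chainSign, links] using h₂
  | cons t T ih =>
    have hlinks : links (r :: t :: T) = (r, t) :: links (t :: T) := rfl
    have hrt : ∀ k ∈ t :: T, r < k := (List.pairwise_cons.mp hL).1
    have hL' := (List.pairwise_cons.mp hL).2
    rcases List.mem_cons.mp hj with rfl | hj
    · have hnil : ((links (j :: t :: T)).filter fun p => decide (p.2 ≤ j)) = [] := by
        rw [List.filter_eq_nil_iff]
        intro p hp
        simpa using hrt p.2 (List.of_mem_zip (show (p.1, p.2) ∈ _ from hp)).2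
      simpa [chainSign, hnil] using h₂
    · have htj : t ≤ j := by
        rcases List.mem_cons.mp hj with rfl | hj'
        · exact le_rfl
        · exact ((List.pairwise_cons.mp hL').1 j hj').le
      have hsplit : chainSign (r :: t :: T) p₂ p₃ j =
          chainSign (t :: T) (p₂ * p₃ (r, t)) p₃ j := by
        rw [chainSign, hlinks, List.filter_cons_of_pos (by simpa using htj), List.map_cons,
          List.prod_cons, ← mul_assoc]
        rfl
      rw [hsplit]
      refine ih t (p₂ * p₃ (r, t)) hL' (fun k hk => he k (List.mem_cons_of_mem _ hk)) ?_
        (fun p hp => h₃ p (hlinks ▸ List.mem_cons_of_mem _ hp)) hj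
      have hr : SignType.sign (e r * e r) = 1 :=
        sign_pos (mul_self_pos.mpr (he r List.mem_cons_self))
      rw [sign_mul, h₂, h₃ (r, t) (hlinks ▸ List.mem_cons_self), ← sign_mul, ← mul_assoc,
        sign_mul, hr, one_mul]

/-! ### Success probability of the protocol -/

section Probability

variable {n : ℕ} {R : Type} {ρ : QOp (Fin n)} {E : R → Prop}

theorem Protocol.prob_nonneg (hρ : IsState ρ) (E : R → Prop) (P : Protocol n R) :
    0 ≤ P.prob ρ E := by
  induction P with
  | done r =>
    rw [Protocol.prob]
    split_ifs <;> norm_num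
  | run k C N next ih =>
    exact Finset.sum_nonneg fun w _ => mul_nonneg
      (Finset.prod_nonneg fun s _ => C.born_nonneg hρ.copyTensor _) (ih w)

/-- If the outcomes of one circuit are good except with probability `a`, and the rest of the
protocol fails with probability at most `b` after good outcomes, the whole fails with
probability at most `a + b`. -/
theorem Protocol.le_prob_run (hρ : IsState ρ) {k : ℕ} {C : Circuit (Fin k × Fin n)} {N : ℕ}
    {next : (Fin N → Bits (Fin k × Fin n)) → Protocol n R}
    {G : (Fin N → Bits (Fin k × Fin n)) → Prop} [DecidablePred G] {a b : ℝ}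
    (ha : 0 ≤ a) (hb : 0 ≤ b) (hb' : b ≤ 1)
    (hG : 1 - a ≤ ∑ w with G w, ∏ s, C.born (copyTensor fun _ => ρ) (w s))
    (h : ∀ w, G w → 1 - b ≤ (next w).prob ρ E) :
    1 - (a + b) ≤ (Protocol.run k C N next).prob ρ E := by
  have hnn : ∀ w : Fin N → Bits (Fin k × Fin n),
      0 ≤ ∏ s, C.born (copyTensor fun _ => ρ) (w s) := fun w =>
    Finset.prod_nonneg fun s _ => C.born_nonneg hρ.copyTensor _
  calc 1 - (a + b) ≤ (1 - a) * (1 - b) := by nlinarith [mul_nonneg ha hb]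
    _ ≤ (∑ w with G w, ∏ s, C.born (copyTensor fun _ => ρ) (w s)) * (1 - b) :=
        mul_le_mul_of_nonneg_right hG (by linarith)
    _ ≤ ∑ w with G w, (∏ s, C.born (copyTensor fun _ => ρ) (w s)) * (next w).prob ρ E := by
        rw [Finset.sum_mul]
        exact Finset.sum_le_sum fun w hw =>
          mul_le_mul_of_nonneg_left (h w (Finset.mem_filter.mp hw).2) (hnn w)
    _ ≤ (Protocol.run k C N next).prob ρ E :=
        Finset.sum_le_sum_of_subset_of_nonneg (Finset.filter_subset _ _) fun w _ _ =>
          mul_nonneg (hnn w) ((next w).prob_nonneg hρ E)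

/-- Running a circuit that measures at most `2 * n` observables with square one: except with
probability `q`, all the empirical means are close to the expectation values. -/
theorem Protocol.le_prob_run_of_close (hρ : IsState ρ) {k : ℕ} {C : Circuit (Fin k × Fin n)}
    (hC : C.Valid) {κ : Type} [Fintype κ] (hκ : Fintype.card κ ≤ 2 * n)
    {O : κ → QOp (Fin k × Fin n)} (hO : ∀ i, C.Measures (O i)) (h1 : ∀ i, O i * O i = 1)
    {N : ℕ} {η q b : ℝ} (hη : 0 ≤ η) (hη' : η ≤ 4)
    (hq : 2 * n * (2 * Real.exp (-(N * (η ^ 2 / 16)))) ≤ q) (hb : 0 ≤ b) (hb' : b ≤ 1)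
    {next : (Fin N → Bits (Fin k × Fin n)) → Protocol n R}
    (h : ∀ w, (∀ i, |C.mean (O i) w - expectation (copyTensor fun _ => ρ) (O i)| < η) →
      1 - b ≤ (next w).prob ρ E) :
    1 - (q + b) ≤ (Protocol.run k C N next).prob ρ E := by
  have hcard : (Fintype.card κ : ℝ) ≤ 2 * n := by exact_mod_cast hκ
  have hq0 : 0 ≤ q := le_trans (by positivity) hq
  have hclose := le_sum_born_forall_close hC hρ.copyTensor hO h1 N hη hη'
  refine Protocol.le_prob_run hρ hq0 hb hb' (le_trans ?_ hclose) h
  have := mul_le_mul_of_nonneg_right hcard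
    (show 0 ≤ 2 * Real.exp (-(N * (η ^ 2 / 16))) by positivity)
  linarith

/-- The sign determination for one family finds all signs except with probability `2 * q`. -/
theorem le_prob_chainStep (hρ : IsState ρ) (a : Axis) {L : List (Fin n)}
    (hL : L.Pairwise (· < ·)) {ε η q b : ℝ} (hη : 0 < η) (hη' : η ≤ 4) (hη₂ : η < ε / 2)
    (hη₃ : η < (ε / 2) * (ε / 2))
    (he : ∀ j ∈ L, ε / 2 ≤ |expectation ρ (majorana a j)|) {N : ℕ}
    (hq : 2 * n * (2 * Real.exp (-(N * (η ^ 2 / 16)))) ≤ q) (hb : 0 ≤ b) (hqb : q + b ≤ 1)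
    {next : (Fin n → SignType) → Protocol n R}
    (h : ∀ s, (∀ j ∈ L, s j = SignType.sign (expectation ρ (majorana a j))) →
      1 - b ≤ (next s).prob ρ E) :
    1 - (q + (q + b)) ≤ (chainStep a L N N next).prob ρ E := by
  have hq0 : 0 ≤ q := le_trans (by positivity) hq
  cases L with
  | nil => exact le_trans (by linarith) (h _ (by simp))
  | cons r T =>
    have hn : 1 ≤ n := Nat.one_le_of_lt r.pos
    refine Protocol.le_prob_run_of_close hρ (firstCircuit_valid a r) (κ := Unit)
      (O := fun _ => copyTensor fun _ => majorana a r) (by simp; omega)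
      (fun _ => firstCircuit_measures a r)
      (fun _ => by simp [copyTensor_mul, majorana_mul_self, copyTensor_one])
      hη.le hη' hq (by linarith) hqb fun w₂ hw₂ => ?_
    have hlen : (links (r :: T)).length ≤ 2 * n := by
      have := List.Nodup.length_le_card (hL.imp ne_of_lt : (r :: T).Nodup)
      rw [Fintype.card_fin, List.length_cons] at this
      simp only [links, List.length_zip, List.length_tail, List.length_cons]
      omega
    refine Protocol.le_prob_run_of_close hρ (chainCircuit_valid (hL.imp ne_of_lt))
      (κ := Fin (links (r :: T)).length)
      (O := fun i => pairOp a ((links (r :: T)).get i).1 ((links (r :: T)).get i).2)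
      (by simpa using hlen) (fun i => chainCircuit_measures hL a (List.get_mem _ _))
      (fun _ => pairOp_mul_self _ _ _) hη.le hη' hq hb (by linarith) fun w₃ hw₃ => h _ ?_
    intro j hj
    have hpos : 0 < ε / 2 := hη.trans hη₂
    refine chainSign_eq (e := fun j => expectation ρ (majorana a j)) r T _ hL
      (fun k hk => abs_pos.mp (hpos.trans_le (he k hk))) ?_ ?_ hj
    · apply sign_eq_of_abs_sub_lt
      have h2 := hw₂ ()
      rw [expectation_copyTensor_one] at h2
      exact h2.trans (hη₂.trans_le (he r List.mem_cons_self))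
    · intro p hp
      obtain ⟨i, rfl⟩ := List.get_of_mem hp
      apply sign_eq_of_abs_sub_lt
      have h3 := hw₃ i
      rw [expectation_pairOp hρ] at h3
      have hmem := List.of_mem_zip (show (_, _) ∈ (r :: T).zip (r :: T).tail from hp)
      refine h3.trans (hη₃.trans_le ?_)
      rw [abs_mul]
      exact mul_le_mul (he _ hmem.1) (he _ (List.mem_of_mem_tail hmem.2)) hpos.le (abs_nonneg _)

theorem abs_sqrt_sub_le {x y d : ℝ} (hy : 0 ≤ y) (hd : 0 ≤ d) (h : |x - y ^ 2| ≤ d ^ 2) :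
    |Real.sqrt x - y| ≤ d := by
  obtain ⟨h1, h2⟩ := abs_le.mp h
  rw [abs_le]
  constructor
  · by_cases hyd : y ≤ d
    · linarith [Real.sqrt_nonneg x]
    · have : y - d ≤ Real.sqrt x := Real.le_sqrt_of_sq_le (by nlinarith)
      linarith
  · have : Real.sqrt x ≤ y + d := Real.sqrt_le_iff.mpr ⟨by positivity, by nlinarith⟩
    linarith

theorem mem_surviving {ε : ℝ} {N : ℕ} {w : Fin N → Bits (Fin 2 × Fin n)} {a : Axis}
    {j : Fin n} : j ∈ surviving ε w a ↔ 3 * ε / 4 ≤ bellMagnitude w a j := by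
  simp [surviving]

/-- Correct magnitudes, together with correct signs of the survivors, make the whole result
correct. -/
theorem Result.correct_of_close {ε : ℝ} (hε : 0 ≤ ε) {N : ℕ}
    {w : Fin N → Bits (Fin 2 × Fin n)} {s : Axis → Fin n → SignType}
    (hw : ∀ a j, |bellMagnitude w a j - abs (expectation ρ (majorana a j))| ≤ ε / 4)
    (hs : ∀ a, ∀ j ∈ surviving ε w a,
      s a j = SignType.sign (expectation ρ (majorana a j))) :
    Result.Correct ρ ε ⟨bellMagnitude w, surviving ε w, s⟩ := by
  intro a j
  have hm := abs_le.mp (hw a j)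
  refine ⟨hw a j, fun h => ?_, fun h => ?_, hs a j, ?_⟩
  · rw [mem_surviving]
    linarith
  · rw [mem_surviving] at h
    linarith
  · rw [Result.estimate]
    by_cases h : j ∈ surviving ε w a
    · have hle : |((SignType.sign (expectation ρ (majorana a j)) : SignType) : ℝ)| ≤ 1 := by
        rcases lt_trichotomy (expectation ρ (majorana a j)) 0 with h | h | h <;> simp [h]
      rw [if_pos h]
      change |((s a j : SignType) : ℝ) * bellMagnitude w a j - expectation ρ (majorana a j)| ≤ ε
      rw [hs a j h]
      calc _ = |((SignType.sign (expectation ρ (majorana a j)) : SignType) : ℝ) *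
            (bellMagnitude w a j - abs (expectation ρ (majorana a j)))| := by
            rw [mul_sub, sign_mul_abs]
        _ ≤ 1 * (ε / 4) := by
            rw [abs_mul]
            exact mul_le_mul hle (hw a j) (abs_nonneg _) zero_le_one
        _ ≤ ε := by linarith
    · rw [if_neg h, zero_sub, abs_neg]
      rw [mem_surviving, not_le] at h
      linarith

/-- The protocol with the same number of shots in all of its five measurements. -/
theorem le_prob_chainedProtocol (hρ : IsState ρ) {ε q : ℝ} (hε : 0 < ε) (hε' : ε ≤ 4)
    {N : ℕ} (hq : 2 * n * (2 * Real.exp (-(N * ((ε ^ 2 / 16) ^ 2 / 16)))) ≤ q)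
    (hq1 : 5 * q ≤ 1) :
    1 - 5 * q ≤ (chainedProtocol n ε N N N).prob ρ (Result.Correct ρ ε) := by
  have hq0 : 0 ≤ q := le_trans (by positivity) hq
  have hη : 0 < ε ^ 2 / 16 := by positivity
  have hη' : ε ^ 2 / 16 ≤ 4 := by nlinarith
  have hη₂ : ε ^ 2 / 16 < ε / 2 := by nlinarith
  have hη₃ : ε ^ 2 / 16 < (ε / 2) * (ε / 2) := by nlinarith [sq_pos_of_pos hε]
  have hsum : 5 * q = q + (q + (q + (q + (q + 0)))) := by ring
  rw [hsum]
  refine Protocol.le_prob_run_of_close hρ bellCircuit_valid (κ := Fin n ⊕ Fin n)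
    (O := Sum.elim (fun j => pairOp .x j j) fun j => pairOp .y j j)
    (by simp; omega) ?_ ?_ hη.le hη' hq (by linarith) (by linarith) fun w hw => ?_
  · rintro (j | j) <;> exact bellCircuit_measures _ j
  · rintro (j | j) <;> exact pairOp_mul_self _ _ _
  have hclose : ∀ (a : Axis) (j : Fin n),
      |bellMagnitude w a j - abs (expectation ρ (majorana a j))| ≤ ε / 4 := by
    intro a j
    have h : |(bellCircuit n).mean (pairOp a j j) w -
        expectation (copyTensor fun _ => ρ) (pairOp a j j)| < ε ^ 2 / 16 := by
      cases a
      · exact hw (Sum.inl j)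
      · exact hw (Sum.inr j)
    rw [expectation_pairOp hρ, ← sq, ← sq_abs (expectation ρ _)] at h
    exact abs_sqrt_sub_le (abs_nonneg _) (by positivity) (h.le.trans (by linarith [sq_nonneg ε]))
  have hsurv : ∀ (a : Axis), ∀ j ∈ (surviving ε w a).sort (· ≤ ·),
      ε / 2 ≤ |expectation ρ (majorana a j)| := by
    intro a j hj
    rw [Finset.mem_sort, mem_surviving] at hj
    linarith [(abs_le.mp (hclose a j)).2]
  refine le_prob_chainStep hρ .x (sort_pairwise_lt _) hη hη' hη₂ hη₃ (hsurv .x) hq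
    (by linarith) (by linarith) fun sx hsx => ?_
  refine le_prob_chainStep hρ .y (sort_pairwise_lt _) hη hη' hη₂ hη₃ (hsurv .y) hq
    le_rfl (by linarith) fun sy hsy => ?_
  rw [Protocol.prob, if_pos, sub_zero]
  refine Result.correct_of_close hε.le hclose ?_
  intro a j hj
  cases a
  · exact hsx j ((Finset.mem_sort _).mpr hj)
  · exact hsy j ((Finset.mem_sort _).mpr hj)

/-- For `ε ≥ 4` no shots are needed: all expectation values are at most `1 ≤ ε / 4` in
magnitude. -/
theorem le_prob_chainedProtocol_zero (hρ : IsState ρ) {ε : ℝ} (hε : 4 ≤ ε) :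
    1 ≤ (chainedProtocol n ε 0 0 0).prob ρ (Result.Correct ρ ε) := by
  have hmag : ∀ (w : Fin 0 → Bits (Fin 2 × Fin n)) (a : Axis) (j : Fin n),
      bellMagnitude w a j = 0 := by
    intro w a j
    simp [bellMagnitude, Circuit.mean]
  have hsurv : ∀ (w : Fin 0 → Bits (Fin 2 × Fin n)) (a : Axis), surviving ε w a = ∅ := by
    intro w a
    refine Finset.eq_empty_of_forall_notMem fun j hj => ?_
    rw [mem_surviving, hmag] at hj
    linarith
  have h := Protocol.le_prob_run (E := Result.Correct ρ ε) (C := bellCircuit n) (N := 0) hρ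
    (a := 0) (b := 0) (G := fun _ => True)
    (next := fun w => chainStep .x ((surviving ε w .x).sort (· ≤ ·)) 0 0 fun sx =>
      chainStep .y ((surviving ε w .y).sort (· ≤ ·)) 0 0 fun sy =>
      .done ⟨bellMagnitude w, surviving ε w, fun a => match a with | .x => sx | .y => sy⟩)
    le_rfl le_rfl zero_le_one (by simp) ?_
  · rw [add_zero, sub_zero] at h
    exact h
  · intro w _
    simp only [hsurv, Finset.sort_empty, chainStep, Protocol.prob]
    rw [if_pos, sub_zero]
    have hc := Result.correct_of_close (ρ := ρ) (ε := ε) (w := w)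
      (s := fun a => match a with | .x => fun _ => 0 | .y => fun _ => 0) (by linarith)
      (fun a j => by
        rw [hmag, zero_sub, abs_neg, abs_abs]
        linarith [abs_expectation_majorana_le hρ a j])
      (fun a j hj => by simp [hsurv] at hj)
    convert hc using 2

end Probability

end ChainedTomography

/-! ### The guarantee with explicit numbers of shots -/

open ChainedTomography in
theorem mainTheorem3 :
    -- the circuits of the protocol measure the observables they are meant to measure
    (∀ (n : ℕ) (a : Axis),
      (∀ j : Fin n, (bellCircuit n).Measures (pairOp a j j)) ∧
      (∀ j : Fin n, (firstCircuit a j).Measures (copyTensor fun _ => majorana a j)) ∧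
      (∀ L : List (Fin n), L.Pairwise (· < ·) →
        (∀ p ∈ links L, ∀ q ∈ links L, Commute (pairOp a p.1 p.2) (pairOp a q.1 q.2)) ∧
        (∀ p ∈ links L, (chainCircuit L).Measures (pairOp a p.1 p.2)))) ∧
    -- guarantee and cost of the protocol
    (∃ C : ℝ, 0 < C ∧
      ∀ (n : ℕ) (ε δ : ℝ), 2 ≤ n → 0 < ε → 1 / ε ^ 2 ≤ (n : ℝ) → 0 < δ → δ < 1 →
        ∃ N₁ N₂ N₃ : ℕ,
          (chainedProtocol n ε N₁ N₂ N₃).Valid ∧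
          (chainedProtocol n ε N₁ N₂ N₃).width ≤ 2 ∧
          (chainedProtocol n ε N₁ N₂ N₃).circuits ≤ 5 ∧
          (chainedProtocol n ε N₁ N₂ N₃).depth ≤ 2 ∧
          ((chainedProtocol n ε N₁ N₂ N₃).samples : ℝ) ≤ C * Real.log (n / δ) / ε ^ 4 ∧
          ∀ ρ : QOp (Fin n), IsState ρ →
            1 - δ ≤ (chainedProtocol n ε N₁ N₂ N₃).prob ρ (Result.Correct ρ ε)) := by
  refine ⟨fun n a => ⟨bellCircuit_measures a, firstCircuit_measures a, fun L hL =>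
    ⟨fun p hp q hq => (chainCircuit_measures hL a hp).commute (chainCircuit_valid
      (hL.imp ne_of_lt)) (chainCircuit_measures hL a hq), fun p hp =>
      chainCircuit_measures hL a hp⟩⟩, 200704, by norm_num, ?_⟩
  intro n ε δ hn hε _ hδ hδ1
  have hn' : (2 : ℝ) ≤ n := by exact_mod_cast hn
  have hnδ : 2 ≤ n / δ := by rw [le_div_iff₀ hδ]; nlinarith
  have hlog : 1 / 2 ≤ Real.log (n / δ) := by
    have h2 : Real.log 2 ≤ Real.log (n / δ) := Real.log_le_log (by norm_num) hnδ
    linarith [Real.log_two_gt_d9]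
  rcases le_total 4 ε with h4 | h4
  · refine ⟨0, 0, 0, chainedProtocol_valid _ _ _ _ _, chainedProtocol_width_le _ _ _ _ _,
      chainedProtocol_circuits_le _ _ _ _ _, chainedProtocol_depth_le _ _ _ _ _, ?_,
      fun ρ hρ => le_trans (by linarith) (le_prob_chainedProtocol_zero hρ h4)⟩
    have h0 : (chainedProtocol n ε 0 0 0).samples = 0 :=
      Nat.le_zero.mp (chainedProtocol_samples_le n ε 0 0 0)
    rw [h0, Nat.cast_zero]
    positivity
  · -- `N` makes the failure probability of each of the five measurements at most `δ / 5`
    set N : ℕ := ⌈4096 * Real.log (20 * n / δ) / ε ^ 4⌉₊ with hN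
    have hε4 : 0 < ε ^ 4 := by positivity
    have hε256 : ε ^ 4 ≤ 256 := by
      calc ε ^ 4 ≤ 4 ^ 4 := pow_le_pow_left₀ hε.le h4 4
        _ = 256 := by norm_num
    -- `20 ≤ 2 ^ 5 ≤ (n / δ) ^ 5`
    have hlog20 : Real.log (20 * n / δ) ≤ 6 * Real.log (n / δ) := by
      have hpow : 20 * n / δ ≤ (n / δ) ^ 6 := by
        have h5 : (2 : ℝ) ^ 5 ≤ (n / δ) ^ 5 := pow_le_pow_left₀ (by norm_num) hnδ 5
        calc 20 * n / δ = 20 * (n / δ) := by ring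
          _ ≤ (n / δ) ^ 5 * (n / δ) :=
            mul_le_mul_of_nonneg_right (le_trans (by norm_num) h5) (by linarith)
          _ = (n / δ) ^ 6 := by ring
      calc Real.log (20 * n / δ) ≤ Real.log ((n / δ) ^ 6) :=
            Real.log_le_log (by positivity) hpow
        _ = 6 * Real.log (n / δ) := by rw [Real.log_pow]; norm_num
    have hlog20' : 0 ≤ Real.log (20 * n / δ) := by
      refine Real.log_nonneg ?_
      rw [mul_div_assoc]
      linarith
    -- `25088 = 6 * 4096 + 512`, where the last term pays for the rounding of `N`
    have hNle : (N : ℝ) ≤ 25088 * Real.log (n / δ) / ε ^ 4 := by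
      have h1 := (Nat.ceil_lt_add_one (div_nonneg (mul_nonneg (by norm_num) hlog20')
        hε4.le : (0 : ℝ) ≤ 4096 * Real.log (20 * n / δ) / ε ^ 4)).le
      refine h1.trans ?_
      rw [div_add_one hε4.ne']
      exact div_le_div_of_nonneg_right (by linarith) hε4.le
    have hNge : Real.log (20 * n / δ) ≤ N * ((ε ^ 2 / 16) ^ 2 / 16) := by
      have h1 := Nat.le_ceil (4096 * Real.log (20 * n / δ) / ε ^ 4)
      rw [← hN, div_le_iff₀ hε4] at h1
      nlinarith
    have hq : 2 * n * (2 * Real.exp (-(N * ((ε ^ 2 / 16) ^ 2 / 16)))) ≤ δ / 5 := by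
      have h1 : Real.exp (-(N * ((ε ^ 2 / 16) ^ 2 / 16))) ≤ (20 * n / δ)⁻¹ := by
        rw [Real.exp_neg]
        refine inv_anti₀ (by positivity) ?_
        rw [← Real.exp_log (show 0 < 20 * n / δ by positivity)]
        exact Real.exp_le_exp.mpr hNge
      calc _ ≤ 2 * n * (2 * (20 * n / δ)⁻¹) := by gcongr
        _ = δ / 5 := by field_simp; norm_num
    refine ⟨N, N, N, chainedProtocol_valid _ _ _ _ _, chainedProtocol_width_le _ _ _ _ _,
      chainedProtocol_circuits_le _ _ _ _ _, chainedProtocol_depth_le _ _ _ _ _, ?_,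
      fun ρ hρ => ?_⟩
    · calc ((chainedProtocol n ε N N N).samples : ℝ)
          ≤ ((2 * N + (N + 2 * N + (N + 2 * N + 0)) : ℕ) : ℝ) := by
            exact_mod_cast chainedProtocol_samples_le n ε N N N
        _ = 8 * N := by push_cast; ring
        _ ≤ 8 * (25088 * Real.log (n / δ) / ε ^ 4) := by linarith
        _ = 200704 * Real.log (n / δ) / ε ^ 4 := by ring
    · have := le_prob_chainedProtocol hρ hε h4 hq (by linarith)
      linarith
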